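/- Let $\mathbb K\in\{\mathbb R,\mathbb C\}$. **Notation.** For a group $G$ of permutations of $\mathbb N=\{1,2,\dots\}$ and $N\in\mathbb N$ let $\mathcal F^N_G$ be the set of orbits of $G$ on $\mathbb N$ with at most $N$ elements; $|G|_\infty$ is the supremum of those $|\mathcal F^N_G|$ that are infinite, and $|G|_\infty=0$ if every $\mathcal F^N_G$ is finite. $G$ acts on a space $X$ of sequences by permuting coordinates (so $g(e_n)=e_{g(n)}$); the action is *compatible with the norm* of $X$ if every $g\in G$ maps $X$ into $X$ and $\|g(x)\|=\|x\|$ for all $x\in X$. For a Banach space $Y$, $\mathcal L_G(X,Y)$ is the normed space of bounded linear $T:X\to Y$ with $T(g(x))=T(x)$ for all $x\in X$, $g\in G$, and $\operatorname{NA}_G(X,Y)$ is the set of $T\in\mathcal L_G(X,Y)$ with $\|T\|=\|T(x_0)\|$ for some $x_0\in X$, $\|x_0\|=1$. For cardinals $\alpha\le\beta$, a subset $M$ of a topological vector space $V$ is *$\alpha$-lineable* if $M\cup\{0\}$ contains a vector subspace of (algebraic) dimension $\alpha$, and *$(\alpha,\beta)$-spaceable in $V$* if it is $\alpha$-lineable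 and each $\alpha$-dimensional vector subspace $V_\alpha\subseteq M\cup\{0\}$ is contained in a closed $\beta$-dimensional vector subspace $V_\beta\subseteq M\cup\{0\}$. For a non-increasing sequence $w\notin\ell_1$ of positive numbers, $d_*(w,1)$ is the space of $x\in c_0$ with $\lim_k \frac{\sum_{i=1}^k[x_i]}{\sum_{i=1}^k w_i}=0$, with norm $\|x\|=\sup_k\frac{\sum_{i=1}^k[x_i]}{\sum_{i=1}^k w_i}$, where $([x_i])_i$ is the non-increasing rearrangement of $(|x_i|)_i$. If moreover $w_1<1$, let $Z$ be the space of scalar sequences $z$ with $\|z\|:=\|(1-w)z\|_\infty+\|wz\|_1<\infty$; $X(w)$ is the closed linear span in $Z^*$ of the functionals $e_n(z)=z_n$, and its elements are identified with their coordinate sequences with respect to $(e_n)$. **Statement.** Let $G$ be a group of permutations of $\mathbb N$ with $|G|_\infty>0$ and let $\alpha\ge\aleph_0$ be a cardinal number. (I) Suppose that $w=(1/n)_{n=1}^\infty$, $1<p<\infty$, and the action of $G$ on $d_*(w,1)$ is compatible with its norm. Then $\mathcal L_G(d_*(w,1),\ell_p)\setminus\overline{\operatorname{NA}_G(d_*(w,1),\ell_p)}$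 is not $(\alpha,\beta)$-spaceable in $\mathcal L_G(d_*(w,1),\ell_p)$ for any cardinal $\beta\ge\alpha$. (II) Let $w\in\ell_2\setminus\ell_1$ be a non-increasing sequence of positive numbers with $w_1<1$ such that the action of $G$ on $X(w)$ is compatible with its norm, and let $Y$ be an infinite-dimensional strictly convex Banach space. (II.1) If $\alpha\le\mathfrak c$, then $\mathcal L_G(X(w),Y)\setminus\overline{\operatorname{NA}_G(X(w),Y)}$ is not $(\alpha,\beta)$-spaceable in $\mathcal L_G(X(w),Y)$ for any cardinal $\beta\ge\alpha$. (II.2) If $Y$ is separable, then $\mathcal L_G(X(w),Y)\setminus\overline{\operatorname{NA}_G(X(w),Y)}$ is not $(\alpha,\beta)$-spaceable in $\mathcal L_G(X(w),Y)$ for any cardinal $\beta\ge\alpha$. -/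

import Mathlib

open Filter Topology Set
open scoped Cardinal ENNReal

universe u v

/-! ## Lineability and `(α, β)`-spaceability -/

section Lineability

variable (𝕜 : Type*) {V : Type u} [Field 𝕜] [AddCommGroup V] [Module 𝕜 V]

/-- The vector subspace `W` has algebraic dimension `α`. The two lifts allow `α` to be a cardinal
of any universe. -/
def HasDimension (W : Submodule 𝕜 V) (α : Cardinal.{v}) : Prop :=
  Cardinal.lift.{v} (Module.rank 𝕜 W) = Cardinal.lift.{u} α

/-- `M` is `α`-lineable: `M ∪ {0}` contains a vector subspace of dimension `α`. -/
def IsLineable (M : Set V) (α : Cardinal.{v}) : Prop :=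
  ∃ W : Submodule 𝕜 V, HasDimension 𝕜 W α ∧ (W : Set V) ⊆ M ∪ {0}

/-- `M` is `(α, β)`-spaceable: it is `α`-lineable, and every `α`-dimensional vector subspace inside
`M ∪ {0}` lies in a closed `β`-dimensional vector subspace inside `M ∪ {0}`. -/
def IsPairSpaceable [TopologicalSpace V] (M : Set V) (α β : Cardinal.{v}) : Prop :=
  IsLineable 𝕜 M α ∧
    ∀ W : Submodule 𝕜 V, HasDimension 𝕜 W α → (W : Set V) ⊆ M ∪ {0} →
      ∃ W' : Submodule 𝕜 V, IsClosed (W' : Set V) ∧ HasDimension 𝕜 W' β ∧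
        W ≤ W' ∧ (W' : Set V) ⊆ M ∪ {0}

end Lineability

/-! ## Groups of permutations -/

section Permutations

variable {Γ : Type u}

/-- The set of orbits of `G` that have at most `N` elements. -/
def boundedOrbits (G : Subgroup (Equiv.Perm Γ)) (N : ℕ) : Set (Set Γ) :=
  {H | (∃ n : Γ, H = MulAction.orbit G n) ∧ H.encard ≤ N}

open Classical in
/-- The cardinal number `|G|_∞`: the supremum of the infinite ones among the cardinalities of the
sets `boundedOrbits G N`, and `0` if all of these sets are finite. -/
noncomputable def permInfty (G : Subgroup (Equiv.Perm Γ)) : Cardinal.{u} :=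
  if ∃ N : ℕ, ℵ₀ ≤ #(boundedOrbits G N) then
    sSup {κ | ∃ N : ℕ, ℵ₀ ≤ #(boundedOrbits G N) ∧ κ = #(boundedOrbits G N)}
  else 0

end Permutations

/-! ## Operators invariant under a group of permutations

A space of sequences is presented as a normed space `X` with its coordinate map
`coord : X →ₗ[𝕜] ℕ → 𝕜`. A permutation `g` acts by permuting coordinates,
`(g x) (g n) = x n`, so that it sends the unit vector `e_n` to `e_{g n}`. -/

section Invariant

variable {𝕜 : Type*} [RCLike 𝕜] {X : Type*} [NormedAddCommGroup X] [NormedSpace 𝕜 X]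

/-- `y` is the image of `x` under the action of `g` on coordinates. -/
def IsPermutedBy (coord : X →ₗ[𝕜] ℕ → 𝕜) (g : Equiv.Perm ℕ) (x y : X) : Prop :=
  ∀ n, coord y (g n) = coord x n

/-- `G` acts on `X` by permuting coordinates, and this action is compatible with the norm. -/
def IsCompatibleAction (coord : X →ₗ[𝕜] ℕ → 𝕜) (G : Subgroup (Equiv.Perm ℕ)) : Prop :=
  ∀ g ∈ G, ∀ x : X, ∃ y : X, IsPermutedBy coord g x y ∧ ‖y‖ = ‖x‖

variable (Y : Type*) [NormedAddCommGroup Y] [NormedSpace 𝕜 Y]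

/-- The normed space of the `G`-invariant bounded linear operators from `X` to `Y`. -/
def invariantOperators (coord : X →ₗ[𝕜] ℕ → 𝕜) (G : Subgroup (Equiv.Perm ℕ)) :
    Submodule 𝕜 (X →L[𝕜] Y) where
  carrier := {T | ∀ g ∈ G, ∀ x y : X, IsPermutedBy coord g x y → T y = T x}
  add_mem' := by
    intro S T hS hT g hg x y h
    simp [hS g hg x y h, hT g hg x y h]
  zero_mem' := by
    intro g _ x y _
    simp
  smul_mem' := by
    intro c T hT g hg x y h
    simp [hT g hg x y h]

variable {Y} in
/-- `T` attains its norm at a point of the unit sphere. -/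
def IsNormAttaining (T : X →L[𝕜] Y) : Prop :=
  ∃ x : X, ‖x‖ = 1 ∧ ‖T x‖ = ‖T‖

/-- The `G`-invariant operators that are not limits of norm-attaining `G`-invariant operators. -/
def nonApproximable (coord : X →ₗ[𝕜] ℕ → 𝕜) (G : Subgroup (Equiv.Perm ℕ)) :
    Set (invariantOperators Y coord G) :=
  (closure {T : invariantOperators Y coord G | IsNormAttaining (T : X →L[𝕜] Y)})ᶜ

end Invariant

/-- A Banach space over `𝕜` is strictly convex if it is so as a real space. -/
def IsStrictlyConvex (𝕜 : Type*) [RCLike 𝕜] (Y : Type*) [NormedAddCommGroup Y]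
    [NormedSpace 𝕜 Y] : Prop :=
  letI : NormedSpace ℝ Y := NormedSpace.restrictScalars ℝ 𝕜 Y
  StrictConvexSpace ℝ Y

/-! ## Weights -/

/-- A non-increasing sequence of positive numbers that is not in `ℓ₁` (indexed from `0`). -/
structure Weight where
  val : ℕ → ℝ
  pos : ∀ n, 0 < val n
  antitone : Antitone val
  not_summable : ¬ Summable val

/-- The weight `1, 1/2, 1/3, …`. -/
noncomputable def harmonicWeight : Weight where
  val n := 1 / ((n : ℝ) + 1)
  pos n := by positivity
  antitone := by
    intro m n h
    have h' : (m : ℝ) ≤ n := by exact_mod_cast h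
    show 1 / ((n : ℝ) + 1) ≤ 1 / ((m : ℝ) + 1)
    gcongr
  not_summable := by
    intro h
    apply Real.not_summable_one_div_natCast
    rw [← summable_nat_add_iff 1]
    simpa using h

/-! ## The predual `d_*(w, 1)` of the Lorentz sequence space -/

section Rearrangement

variable {𝕜 : Type*} [RCLike 𝕜]

/-- The non-increasing rearrangement of `(|x n|)`: its term of index `i` (counted from `0`) is the
least `t ≥ 0` such that at most `i` of the numbers `|x n|` exceed `t`. -/
noncomputable def rearrangement (x : ℕ → 𝕜) (i : ℕ) : ℝ :=
  sInf {t : ℝ | 0 ≤ t ∧ {n | t < ‖x n‖}.encard ≤ i}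

/-- The sum of the first `k` terms of the non-increasing rearrangement. -/
noncomputable def rearrangementSum (x : ℕ → 𝕜) (k : ℕ) : ℝ :=
  ∑ i ∈ Finset.range k, rearrangement x i

/-- A finite set of indices at which `|x|` is largest can be enlarged by one index. -/
lemma exists_next_index {x : ℕ → 𝕜} (hx : Tendsto x atTop (𝓝 0)) (F : Finset ℕ)
    (hF : ∀ m ∈ F, ∀ n ∉ F, ‖x n‖ ≤ ‖x m‖) :
    ∃ n₀ ∉ F, (∀ n ∉ F, ‖x n‖ ≤ ‖x n₀‖) ∧ ‖x n₀‖ = rearrangement x F.card := by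
  obtain ⟨n₀, hn₀, hmax⟩ : ∃ n₀ ∉ F, ∀ n ∉ F, ‖x n‖ ≤ ‖x n₀‖ := by
    by_cases h : ∃ m ∉ F, x m ≠ 0
    · obtain ⟨m, hm, hm0⟩ := h
      have hfin : ∀ᶠ n in atTop, ‖x n‖ < ‖x m‖ := by
        have := hx.norm
        rw [norm_zero] at this
        exact this.eventually (gt_mem_nhds (norm_pos_iff.2 hm0))
      obtain ⟨N, hN⟩ := eventually_atTop.1 hfin
      have hmem : m ∈ (Finset.range (N + m + 1)).filter (· ∉ F) := by
        simp [hm]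
      obtain ⟨n₀, h₀, hbest⟩ := Finset.exists_max_image _ (fun n => ‖x n‖) ⟨m, hmem⟩
      refine ⟨n₀, (Finset.mem_filter.1 h₀).2, fun n hn => ?_⟩
      by_cases hnN : n < N + m + 1
      · exact hbest n (by simp [hn]; omega)
      · exact (hN n (by omega)).le.trans (hbest m hmem)
    · push Not at h
      obtain ⟨m, hm⟩ := Infinite.exists_notMem_finset F
      exact ⟨m, hm, fun n hn => by simp [h n hn, h m hm]⟩
  refine ⟨n₀, hn₀, hmax, le_antisymm ?_ ?_⟩
  · refine le_csInf ⟨‖x n₀‖, norm_nonneg _, ?_⟩ ?_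
    · rw [← Set.encard_coe_eq_coe_finsetCard]
      refine Set.encard_le_encard fun n hn => ?_
      by_contra hnF
      exact absurd (hmax n hnF) (not_le.2 hn)
    · rintro t ⟨-, ht⟩
      by_contra hlt
      push Not at hlt
      have hsub : ((insert n₀ F : Finset ℕ) : Set ℕ) ⊆ {n | t < ‖x n‖} := by
        intro n hn
        rcases Finset.mem_insert.1 (Finset.mem_coe.1 hn) with rfl | hn
        · exact hlt
        · exact hlt.trans_le (hF n hn n₀ hn₀)
      have h1 := (Set.encard_le_encard hsub).trans ht
      rw [Set.encard_coe_eq_coe_finsetCard, Finset.card_insert_of_notMem hn₀] at h1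
      have h2 : F.card + 1 ≤ F.card := by exact_mod_cast h1
      omega
  · refine csInf_le ⟨0, fun t ht => ht.1⟩ ⟨norm_nonneg _, ?_⟩
    rw [← Set.encard_coe_eq_coe_finsetCard]
    refine Set.encard_le_encard fun n hn => ?_
    by_contra hnF
    exact absurd (hmax n hnF) (not_le.2 hn)

lemma exists_top_indices {x : ℕ → 𝕜} (hx : Tendsto x atTop (𝓝 0)) (k : ℕ) :
    ∃ F : Finset ℕ, F.card = k ∧ (∀ m ∈ F, ∀ n ∉ F, ‖x n‖ ≤ ‖x m‖) ∧
      ∑ n ∈ F, ‖x n‖ = rearrangementSum x k := by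
  induction k with
  | zero => exact ⟨∅, by simp [rearrangementSum]⟩
  | succ k ih =>
    obtain ⟨F, hc, hF, hs⟩ := ih
    obtain ⟨n₀, hn₀, hmax, heq⟩ := exists_next_index hx F hF
    refine ⟨insert n₀ F, by rw [Finset.card_insert_of_notMem hn₀, hc], ?_, ?_⟩
    · intro m hm n hn
      have hnF : n ∉ F := fun h => hn (Finset.mem_insert_of_mem h)
      rcases Finset.mem_insert.1 hm with rfl | hm
      · exact hmax n hnF
      · exact hF m hm n hnF
    · rw [Finset.sum_insert hn₀, hs, heq, hc, rearrangementSum, rearrangementSum,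
        Finset.sum_range_succ, add_comm]

/-- The sum of the first `k` terms of the rearrangement dominates every sum of `k` terms. -/
lemma sum_le_rearrangementSum {x : ℕ → 𝕜} (hx : Tendsto x atTop (𝓝 0)) (E : Finset ℕ) :
    ∑ n ∈ E, ‖x n‖ ≤ rearrangementSum x E.card := by
  obtain ⟨F, hc, hF, hs⟩ := exists_top_indices hx E.card
  obtain ⟨n₀, hn₀, hmax, -⟩ := exists_next_index hx F hF
  rw [← hs, ← Finset.sum_inter_add_sum_sdiff E F, ← Finset.sum_inter_add_sum_sdiff F E,
    Finset.inter_comm F E]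
  have hcard : (E \ F).card = (F \ E).card := Finset.card_sdiff_comm hc.symm
  have h1 : ∑ n ∈ E \ F, ‖x n‖ ≤ (E \ F).card • ‖x n₀‖ :=
    Finset.sum_le_card_nsmul _ _ _ fun n hn => hmax n (Finset.mem_sdiff.1 hn).2
  have h2 : (F \ E).card • ‖x n₀‖ ≤ ∑ n ∈ F \ E, ‖x n‖ :=
    Finset.card_nsmul_le_sum _ _ _ fun n hn => hF n (Finset.mem_sdiff.1 hn).1 n₀ hn₀
  rw [hcard] at h1
  linarith

lemma rearrangement_nonneg (x : ℕ → 𝕜) (i : ℕ) : 0 ≤ rearrangement x i :=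
  Real.sInf_nonneg fun _ ht => ht.1

lemma rearrangementSum_nonneg (x : ℕ → 𝕜) (k : ℕ) : 0 ≤ rearrangementSum x k :=
  Finset.sum_nonneg fun i _ => rearrangement_nonneg x i

lemma rearrangementSum_add_le {x y : ℕ → 𝕜} (hx : Tendsto x atTop (𝓝 0))
    (hy : Tendsto y atTop (𝓝 0)) (k : ℕ) :
    rearrangementSum (x + y) k ≤ rearrangementSum x k + rearrangementSum y k := by
  have hxy : Tendsto (x + y) atTop (𝓝 0) := by simpa using! hx.add hy
  obtain ⟨F, hc, -, hs⟩ := exists_top_indices hxy k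
  rw [← hs, ← hc]
  calc ∑ n ∈ F, ‖(x + y) n‖ ≤ ∑ n ∈ F, (‖x n‖ + ‖y n‖) :=
        Finset.sum_le_sum fun n _ => norm_add_le _ _
    _ = ∑ n ∈ F, ‖x n‖ + ∑ n ∈ F, ‖y n‖ := Finset.sum_add_distrib
    _ ≤ _ := add_le_add (sum_le_rearrangementSum hx F) (sum_le_rearrangementSum hy F)

lemma rearrangementSum_smul {x : ℕ → 𝕜} (hx : Tendsto x atTop (𝓝 0)) (c : 𝕜) (k : ℕ) :
    rearrangementSum (c • x) k = ‖c‖ * rearrangementSum x k := by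
  have hcx : Tendsto (c • x) atTop (𝓝 0) := by simpa using! hx.const_smul c
  apply le_antisymm
  · obtain ⟨F, hc, -, hs⟩ := exists_top_indices hcx k
    have := sum_le_rearrangementSum hx F
    rw [hc] at this
    rw [← hs]
    simp only [Pi.smul_apply, norm_smul, ← Finset.mul_sum]
    exact mul_le_mul_of_nonneg_left this (norm_nonneg _)
  · obtain ⟨F, hc, -, hs⟩ := exists_top_indices hx k
    have := sum_le_rearrangementSum hcx F
    rw [hc] at this
    rw [← hs]
    simpa only [Pi.smul_apply, norm_smul, ← Finset.mul_sum] using this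

lemma rearrangementSum_zero (k : ℕ) : rearrangementSum (0 : ℕ → 𝕜) k = 0 := by
  have := rearrangementSum_smul (x := (0 : ℕ → 𝕜)) tendsto_const_nhds 0 k
  simpa using this

end Rearrangement

section DStar

variable (𝕜 : Type*) [RCLike 𝕜] (w : Weight)

/-- `w_1 + ⋯ + w_k` -/
noncomputable def Weight.partialSum (k : ℕ) : ℝ := ∑ i ∈ Finset.range k, w.val i

lemma Weight.partialSum_nonneg (k : ℕ) : 0 ≤ w.partialSum k :=
  Finset.sum_nonneg fun i _ => (w.pos i).le

/-- The quotient `([x_1] + ⋯ + [x_k]) / (w_1 + ⋯ + w_k)`. -/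
noncomputable def lorentzRatio {𝕜 : Type*} [RCLike 𝕜] (w : Weight) (x : ℕ → 𝕜) (k : ℕ) : ℝ :=
  rearrangementSum x k / w.partialSum k

/-- The vector space `d_*(w, 1)` of the sequences `x ∈ c₀` with
`([x_1] + ⋯ + [x_k]) / (w_1 + ⋯ + w_k) → 0`. -/
def dStarSubmodule : Submodule 𝕜 (ℕ → 𝕜) where
  carrier := {x | Tendsto x atTop (𝓝 0) ∧ Tendsto (lorentzRatio w x) atTop (𝓝 0)}
  zero_mem' := by
    refine ⟨tendsto_const_nhds, ?_⟩
    have : lorentzRatio w (0 : ℕ → 𝕜) = fun _ => 0 := by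
      funext k
      simp [lorentzRatio, rearrangementSum_zero]
    rw [this]
    exact tendsto_const_nhds
  add_mem' := by
    rintro x y ⟨hx, hx'⟩ ⟨hy, hy'⟩
    refine ⟨by simpa using! hx.add hy, ?_⟩
    refine squeeze_zero (g := fun k => lorentzRatio w x k + lorentzRatio w y k) ?_ ?_ ?_
    · exact fun k => div_nonneg (rearrangementSum_nonneg _ _) (w.partialSum_nonneg k)
    · intro k
      simp only [lorentzRatio, ← add_div]
      exact div_le_div_of_nonneg_right (rearrangementSum_add_le hx hy k) (w.partialSum_nonneg k)
    · simpa using hx'.add hy'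
  smul_mem' := by
    rintro c x ⟨hx, hx'⟩
    refine ⟨by simpa using! hx.const_smul c, ?_⟩
    have : lorentzRatio w (c • x) = fun k => ‖c‖ * lorentzRatio w x k := by
      funext k
      simp only [lorentzRatio, rearrangementSum_smul hx, mul_div_assoc]
    rw [this]
    simpa using hx'.const_mul ‖c‖

/-- The space `d_*(w, 1)`. -/
def DStar : Type _ := dStarSubmodule 𝕜 w

namespace DStar

noncomputable instance : AddCommGroup (DStar 𝕜 w) :=
  inferInstanceAs (AddCommGroup (dStarSubmodule 𝕜 w))

noncomputable instance : Module 𝕜 (DStar 𝕜 w) :=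
  inferInstanceAs (Module 𝕜 (dStarSubmodule 𝕜 w))

/-- The coordinates of an element of `d_*(w, 1)`. -/
def coord : DStar 𝕜 w →ₗ[𝕜] ℕ → 𝕜 := (dStarSubmodule 𝕜 w).subtype

variable {𝕜 w}

/-- The norm `‖x‖ = sup_k ([x_1] + ⋯ + [x_k]) / (w_1 + ⋯ + w_k)`. -/
noncomputable instance : Norm (DStar 𝕜 w) where
  norm x := ⨆ k : ℕ, lorentzRatio w (coord 𝕜 w x) (k + 1)

lemma norm_def (x : DStar 𝕜 w) : ‖x‖ = ⨆ k : ℕ, lorentzRatio w (coord 𝕜 w x) (k + 1) := rfl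

lemma coord_tendsto (x : DStar 𝕜 w) : Tendsto (coord 𝕜 w x) atTop (𝓝 0) := x.2.1

lemma coord_injective : Function.Injective (coord 𝕜 w) := Subtype.val_injective

lemma bddAbove_ratio (x : DStar 𝕜 w) :
    BddAbove (range fun k : ℕ => lorentzRatio w (coord 𝕜 w x) (k + 1)) :=
  ((tendsto_add_atTop_iff_nat 1).2 x.2.2).bddAbove_range

lemma ratio_nonneg (x : DStar 𝕜 w) (k : ℕ) : 0 ≤ lorentzRatio w (coord 𝕜 w x) k :=
  div_nonneg (rearrangementSum_nonneg _ _) (w.partialSum_nonneg k)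

lemma core : NormedSpace.Core 𝕜 (DStar 𝕜 w) where
  norm_nonneg x := Real.iSup_nonneg fun k => ratio_nonneg x (k + 1)
  norm_smul c x := by
    rw [norm_def, norm_def, Real.mul_iSup_of_nonneg (norm_nonneg c)]
    congr 1
    funext k
    rw [map_smul, lorentzRatio, rearrangementSum_smul (coord_tendsto x), mul_div_assoc,
      lorentzRatio]
  norm_triangle x y := by
    rw [norm_def]
    refine ciSup_le fun k => ?_
    have h : lorentzRatio w (coord 𝕜 w (x + y)) (k + 1) ≤
        lorentzRatio w (coord 𝕜 w x) (k + 1) + lorentzRatio w (coord 𝕜 w y) (k + 1) := by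
      rw [map_add]
      simp only [lorentzRatio, ← add_div]
      exact div_le_div_of_nonneg_right
        (rearrangementSum_add_le (coord_tendsto x) (coord_tendsto y) _) (w.partialSum_nonneg _)
    exact h.trans (add_le_add (le_ciSup (bddAbove_ratio x) k) (le_ciSup (bddAbove_ratio y) k))
  norm_eq_zero_iff x := by
    constructor
    · intro h
      apply coord_injective
      rw [map_zero]
      funext n
      have h1 : lorentzRatio w (coord 𝕜 w x) (0 + 1) ≤ 0 :=
        (le_ciSup (bddAbove_ratio x) 0).trans (le_of_eq h)
      have h2 : ‖coord 𝕜 w x n‖ ≤ rearrangementSum (coord 𝕜 w x) (0 + 1) := by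
        simpa using sum_le_rearrangementSum (coord_tendsto x) {n}
      have h3 : 0 < w.partialSum (0 + 1) := by simpa [Weight.partialSum] using w.pos 0
      rw [lorentzRatio, div_le_iff₀ h3, zero_mul] at h1
      exact norm_le_zero_iff.1 (h2.trans h1)
    · rintro rfl
      simp [norm_def, lorentzRatio, rearrangementSum_zero]

noncomputable instance : NormedAddCommGroup (DStar 𝕜 w) := NormedAddCommGroup.ofCore core

noncomputable instance : NormedSpace 𝕜 (DStar 𝕜 w) := NormedSpace.ofCore core

end DStar

end DStar

/-! ## The space `X(w)` -/

section XSpace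

variable (𝕜 : Type*) [RCLike 𝕜] (w : Weight)

/-- The vector space `Z` of the sequences `z` with `(1 - w) z ∈ ℓ_∞` and `w z ∈ ℓ₁`. -/
def zSubmodule : Submodule 𝕜 (ℕ → 𝕜) where
  carrier := {z | BddAbove (range fun n => |1 - w.val n| * ‖z n‖) ∧
    Summable fun n => w.val n * ‖z n‖}
  zero_mem' := by
    refine ⟨⟨0, ?_⟩, by simp⟩
    rintro _ ⟨n, rfl⟩
    simp
  add_mem' := by
    rintro x y ⟨⟨a, hx⟩, hx'⟩ ⟨⟨b, hy⟩, hy'⟩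
    refine ⟨⟨a + b, ?_⟩, Summable.of_nonneg_of_le (fun n => ?_) (fun n => ?_) (hx'.add hy')⟩
    · rintro _ ⟨n, rfl⟩
      have h1 := hx ⟨n, rfl⟩
      have h2 := hy ⟨n, rfl⟩
      have h3 := mul_le_mul_of_nonneg_left (norm_add_le (x n) (y n)) (abs_nonneg (1 - w.val n))
      simp only [Pi.add_apply] at *
      linarith
    · exact mul_nonneg (w.pos n).le (norm_nonneg _)
    · have h3 := mul_le_mul_of_nonneg_left (norm_add_le (x n) (y n)) (w.pos n).le
      simp only [Pi.add_apply] at *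
      linarith
  smul_mem' := by
    rintro c x ⟨⟨a, hx⟩, hx'⟩
    refine ⟨⟨‖c‖ * a, ?_⟩, ?_⟩
    · rintro _ ⟨n, rfl⟩
      have h1 := mul_le_mul_of_nonneg_left (hx ⟨n, rfl⟩) (norm_nonneg c)
      simp only [Pi.smul_apply, norm_smul] at *
      linarith
    · refine (hx'.mul_left ‖c‖).congr fun n => ?_
      simp only [Pi.smul_apply, norm_smul]
      ring

/-- The Banach space `Z` whose dual contains `X(w)`. -/
def ZSpace : Type _ := zSubmodule 𝕜 w

namespace ZSpace

noncomputable instance : AddCommGroup (ZSpace 𝕜 w) :=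
  inferInstanceAs (AddCommGroup (zSubmodule 𝕜 w))

noncomputable instance : Module 𝕜 (ZSpace 𝕜 w) :=
  inferInstanceAs (Module 𝕜 (zSubmodule 𝕜 w))

/-- The terms of an element of `Z`. -/
def coord : ZSpace 𝕜 w →ₗ[𝕜] ℕ → 𝕜 := (zSubmodule 𝕜 w).subtype

variable {𝕜 w}

/-- The norm `‖z‖ = ‖(1 - w) z‖_∞ + ‖w z‖_1`. -/
noncomputable instance : Norm (ZSpace 𝕜 w) where
  norm z := (⨆ n, |1 - w.val n| * ‖coord 𝕜 w z n‖) + ∑' n, w.val n * ‖coord 𝕜 w z n‖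

lemma norm_def (z : ZSpace 𝕜 w) :
    ‖z‖ = (⨆ n, |1 - w.val n| * ‖coord 𝕜 w z n‖) + ∑' n, w.val n * ‖coord 𝕜 w z n‖ := rfl

lemma coord_injective : Function.Injective (coord 𝕜 w) := Subtype.val_injective

lemma bddAbove (z : ZSpace 𝕜 w) :
    BddAbove (range fun n => |1 - w.val n| * ‖coord 𝕜 w z n‖) := z.2.1

lemma summable (z : ZSpace 𝕜 w) : Summable fun n => w.val n * ‖coord 𝕜 w z n‖ := z.2.2

lemma iSup_nonneg (z : ZSpace 𝕜 w) : 0 ≤ ⨆ n, |1 - w.val n| * ‖coord 𝕜 w z n‖ :=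
  Real.iSup_nonneg fun _ => by positivity

lemma term_nonneg (z : ZSpace 𝕜 w) (n : ℕ) : 0 ≤ w.val n * ‖coord 𝕜 w z n‖ :=
  mul_nonneg (w.pos n).le (norm_nonneg _)

/-- `|z_n| ≤ ‖z‖` -/
lemma norm_coord_le (z : ZSpace 𝕜 w) (n : ℕ) : ‖coord 𝕜 w z n‖ ≤ ‖z‖ := by
  have h1 : |1 - w.val n| * ‖coord 𝕜 w z n‖ ≤ ⨆ n, |1 - w.val n| * ‖coord 𝕜 w z n‖ :=
    le_ciSup (bddAbove z) n
  have h2 : w.val n * ‖coord 𝕜 w z n‖ ≤ ∑' n, w.val n * ‖coord 𝕜 w z n‖ :=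
    (summable z).le_tsum n fun m _ => term_nonneg z m
  have h3 := mul_le_mul_of_nonneg_right (le_abs_self (1 - w.val n)) (norm_nonneg (coord 𝕜 w z n))
  rw [norm_def]
  linarith

lemma core : NormedSpace.Core 𝕜 (ZSpace 𝕜 w) where
  norm_nonneg z := add_nonneg (iSup_nonneg z) (tsum_nonneg (term_nonneg z))
  norm_smul c z := by
    rw [norm_def, norm_def, mul_add, Real.mul_iSup_of_nonneg (norm_nonneg c), ← tsum_mul_left]
    simp only [map_smul, Pi.smul_apply, norm_smul, mul_left_comm]
  norm_triangle x y := by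
    have h1 : (⨆ n, |1 - w.val n| * ‖coord 𝕜 w (x + y) n‖) ≤
        (⨆ n, |1 - w.val n| * ‖coord 𝕜 w x n‖) + ⨆ n, |1 - w.val n| * ‖coord 𝕜 w y n‖ := by
      refine ciSup_le fun n => ?_
      refine le_trans ?_ (add_le_add (le_ciSup (bddAbove x) n) (le_ciSup (bddAbove y) n))
      rw [map_add, ← mul_add]
      exact mul_le_mul_of_nonneg_left (norm_add_le _ _) (abs_nonneg _)
    have h2 : (∑' n, w.val n * ‖coord 𝕜 w (x + y) n‖) ≤
        (∑' n, w.val n * ‖coord 𝕜 w x n‖) + ∑' n, w.val n * ‖coord 𝕜 w y n‖ := by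
      rw [← (summable x).tsum_add (summable y)]
      refine (summable (x + y)).tsum_le_tsum (fun n => ?_) ((summable x).add (summable y))
      rw [map_add, ← mul_add]
      exact mul_le_mul_of_nonneg_left (norm_add_le _ _) (w.pos n).le
    simp only [norm_def]
    linarith
  norm_eq_zero_iff z := by
    constructor
    · intro h
      apply coord_injective
      rw [map_zero]
      funext n
      exact norm_le_zero_iff.1 ((norm_coord_le z n).trans h.le)
    · rintro rfl
      simp [norm_def]

noncomputable instance : NormedAddCommGroup (ZSpace 𝕜 w) := NormedAddCommGroup.ofCore core

noncomputable instance : NormedSpace 𝕜 (ZSpace 𝕜 w) := NormedSpace.ofCore core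

variable (𝕜 w)

/-- The functional `e_n ∈ Z*`, `e_n(z) = z_n`. -/
noncomputable def evalAt (n : ℕ) : StrongDual 𝕜 (ZSpace 𝕜 w) :=
  LinearMap.mkContinuous ((LinearMap.proj n).comp (coord 𝕜 w)) 1 fun z => by
    simpa using norm_coord_le z n

/-- The sequence `(0, …, 0, 1, 0, …)` as an element of `Z`. -/
noncomputable def single (n : ℕ) : ZSpace 𝕜 w :=
  ⟨Pi.single n 1, by
    have hne : ∀ m ≠ n, ‖(Pi.single n 1 : ℕ → 𝕜) m‖ = 0 := fun m hm => by
      rw [Pi.single_eq_of_ne hm, norm_zero]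
    refine ⟨⟨|1 - w.val n|, ?_⟩, ?_⟩
    · rintro _ ⟨m, rfl⟩
      rcases eq_or_ne m n with rfl | hm
      · simp
      · simp [hne m hm]
    · refine summable_of_ne_finset_zero (s := {n}) fun m hm => ?_
      rw [hne m (by simpa using hm), mul_zero]⟩

end ZSpace

/-- The closed linear span of the functionals `e_n` in `Z*`. -/
noncomputable def xSubmodule : Submodule 𝕜 (StrongDual 𝕜 (ZSpace 𝕜 w)) :=
  (Submodule.span 𝕜 (range (ZSpace.evalAt 𝕜 w))).topologicalClosure

/-- The space `X(w)`: the closed linear span of the functionals `e_n` in `Z*`, with the norm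
of `Z*`. -/
def XSpace : Type _ := xSubmodule 𝕜 w

namespace XSpace

noncomputable instance : NormedAddCommGroup (XSpace 𝕜 w) :=
  inferInstanceAs (NormedAddCommGroup (xSubmodule 𝕜 w))

noncomputable instance : NormedSpace 𝕜 (XSpace 𝕜 w) :=
  inferInstanceAs (NormedSpace 𝕜 (xSubmodule 𝕜 w))

/-- The inclusion of `X(w)` in `Z*`. -/
noncomputable def toDual : XSpace 𝕜 w →ₗ[𝕜] StrongDual 𝕜 (ZSpace 𝕜 w) :=
  (xSubmodule 𝕜 w).subtype

/-- The coordinates of an element of `X(w)` with respect to the basis `(e_n)`: the biorthogonal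
functionals are the evaluations at the unit sequences of `Z`. -/
noncomputable def coord : XSpace 𝕜 w →ₗ[𝕜] ℕ → 𝕜 where
  toFun x n := toDual 𝕜 w x (ZSpace.single 𝕜 w n)
  map_add' x y := by
    funext n
    simp
  map_smul' c x := by
    funext n
    simp

end XSpace

end XSpace

/-! ## A criterion for the failure of spaceability -/

/-! In both cases the closure of the norm-attaining invariant operators is a closed subspace `N ≠
0`, and the complement of such a subspace is never spaceable for infinite `α`. Indeed, if `W` meets
`N` only in `0`, pick `b ∈ N` nonzero and an unbounded functional `φ` on `W`: the space of all `x +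
φ x • b` has the same dimension and still meets `N` only in `0`, but its closure contains `b`. No
closed space between it and the complement of `N` can exist (`not_isPairSpaceable_compl`). A finite
orbit `O`, which exists since `|G|_∞ > 0`, gives `b`: the operator `x ↦ (∑ n ∈ O, x n) • v`.

It remains to identify `N`. If `T` attains its norm at `x` and the range is strictly convex, `T`
kills each direction in which `x` can move both ways inside the ball. In `d_*(w,1)` all far unit
vectors are such directions (`exists_norm_add_unit_le`), so the norm-attaining operators are exactly
those with `T e_n = 0` for large `n`; these form a subspace.

In `X(w)`, the norm of `Z` is a sum of two norms, so the ball is described by a Minkowski sum: `‖x‖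
≤ 1` iff the relative excesses `(|x_n| - w_n)⁺ / (1 - w_n)` add up to at most `1`. Coordinates with
`|x_n| < w_n` are free to move, and those with `|x_n| ≥ w_n` have summable weights; hence a
norm-attaining operator has a support of summable weight. Such operators form a subspace, and each
is a limit of norm-attaining ones (`mem_closure_isNormAttaining`): its norm is a supremum over
vertices indexed by `m` and a compact cube, so if it is not attained, it is approached at far `m`.
The orbit of such an `m` is finite and light, and a small invariant rank-one perturbation on that
orbit favours its vertices over all others, making compactness yield a maximum. -/

/-- The complement of a set `N` that is a nonzero vector subspace is not `(α, β)`-spaceable for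
infinite `α`: a complementary subspace can be tilted so that its closure meets `N`. -/
theorem not_isPairSpaceable_compl {𝕜 : Type*} {V : Type u} [RCLike 𝕜] [NormedAddCommGroup V]
    [NormedSpace 𝕜 V] (N : Submodule 𝕜 V) {b : V} (hb : b ∈ N) (hb0 : b ≠ 0)
    {α β : Cardinal.{v}} (hα : ℵ₀ ≤ α) : ¬ IsPairSpaceable 𝕜 ((N : Set V)ᶜ) α β := by
  rintro ⟨⟨W, hWdim, hW⟩, hsp⟩
  have hWN : ∀ x ∈ W, x ∈ N → x = 0 := fun x hx hxN => by
    rcases hW hx with h | h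
    · exact absurd hxN h
    · exact h
  have hrank : ℵ₀ ≤ Module.rank 𝕜 W := by
    have h : Cardinal.lift.{u} ℵ₀ ≤ Cardinal.lift.{u} α := Cardinal.lift_le.2 hα
    rw [← hWdim, Cardinal.lift_aleph0, Cardinal.aleph0_le_lift] at h
    exact h
  let B := Module.Basis.ofVectorSpace 𝕜 W
  have : Infinite (Module.Basis.ofVectorSpaceIndex 𝕜 W) := by
    rw [Cardinal.infinite_iff, B.mk_eq_rank'']
    exact hrank
  let i := Infinite.natEmbedding (Module.Basis.ofVectorSpaceIndex 𝕜 W)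
  -- The values grow faster than the norms of the basis vectors, so `B (i n) / φ (B (i n))` has norm
  -- `1 / (n + 1)`, while `L` sends it to itself plus exactly `b`.
  let φ : W →ₗ[𝕜] 𝕜 := B.constr 𝕜
    (Function.extend i (fun n => ((((n : ℝ) + 1) * ‖B (i n)‖ : ℝ) : 𝕜)) fun _ => 0)
  have hφ : ∀ n, φ (B (i n)) = ((((n : ℝ) + 1) * ‖B (i n)‖ : ℝ) : 𝕜) := fun n => by
    simp only [φ, Module.Basis.constr_basis]
    exact i.injective.extend_apply _ _ _
  let L : W →ₗ[𝕜] V := W.subtype + φ.smulRight b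
  have hL : ∀ x, L x = x + φ x • b := fun x => by simp [L]
  -- Modulo `N` the tilt is invisible, because `b ∈ N`; this also makes `L` injective, so the
  -- dimension is kept.
  have hLN : ∀ x, L x ∈ N → x = 0 := fun x hx => by
    rw [hL] at hx
    exact Subtype.ext (hWN x x.2 ((N.add_mem_iff_left (N.smul_mem _ hb)).1 hx))
  have hinj : Function.Injective L := by
    rw [← LinearMap.ker_eq_bot, LinearMap.ker_eq_bot']
    exact fun x hx => hLN x (hx ▸ N.zero_mem)
  obtain ⟨W', hclosed, -, hle, hW'⟩ := hsp (LinearMap.range L)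
    (by rw [HasDimension, ← (LinearEquiv.ofInjective L hinj).rank_eq]; exact hWdim) (by
      rintro _ ⟨x, rfl⟩
      by_cases hx : L x ∈ N
      · rw [hLN x hx]
        simp
      · exact Or.inl hx)
  have hlim : Tendsto (fun n => L ((φ (B (i n)))⁻¹ • B (i n))) atTop (𝓝 b) := by
    have h0 : ∀ n, φ (B (i n)) ≠ 0 := fun n => by
      rw [hφ]
      have : 0 < ‖B (i n)‖ := norm_pos_iff.2 (B.ne_zero _)
      exact_mod_cast (by positivity : (((n : ℝ) + 1) * ‖B (i n)‖) ≠ 0)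
    have h1 : Tendsto (fun n => (φ (B (i n)))⁻¹ • (B (i n) : V)) atTop (𝓝 0) := by
      refine squeeze_zero_norm (fun n => ?_) (tendsto_one_div_add_atTop_nhds_zero_nat (𝕜 := ℝ))
      have h2 : 0 < ‖B (i n)‖ := norm_pos_iff.2 (B.ne_zero _)
      rw [norm_smul, norm_inv, hφ, RCLike.norm_ofReal, abs_of_nonneg (by positivity),
        Submodule.coe_norm]
      rw [Submodule.coe_norm] at h2
      field_simp
      exact le_rfl
    have h3 := h1.add_const b
    rw [zero_add] at h3
    refine h3.congr fun n => ?_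
    rw [hL, map_smul, smul_eq_mul, inv_mul_cancel₀ (h0 n), one_smul]
    rfl
  have hbW' : b ∈ W' := hclosed.mem_of_tendsto hlim (Eventually.of_forall fun n => hle ⟨_, rfl⟩)
  rcases hW' hbW' with h | h
  · exact h hb
  · exact hb0 h

/-! ## Finite orbits -/

/-- Positivity forces some set of bounded orbits to be infinite, hence nonempty; a single finite
orbit is all that is needed. -/
theorem exists_finite_orbit_of_permInfty_pos {Γ : Type u} {G : Subgroup (Equiv.Perm Γ)}
    (hG : 0 < permInfty G) : ∃ n : Γ, (MulAction.orbit G n).Finite := by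
  unfold permInfty at hG
  split_ifs at hG with h
  · obtain ⟨N, hN⟩ := h
    have : Infinite (boundedOrbits G N) := Cardinal.infinite_iff.2 hN
    obtain ⟨⟨H, ⟨n, rfl⟩, hn⟩⟩ := (inferInstance : Nonempty (boundedOrbits G N))
    exact ⟨n, finite_of_encard_le_coe hn⟩
  · exact absurd hG (lt_irrefl _)

theorem apply_mem_orbit_iff {Γ : Type u} {G : Subgroup (Equiv.Perm Γ)} {g : Equiv.Perm Γ}
    (hg : g ∈ G) (m n : Γ) : g n ∈ MulAction.orbit G m ↔ n ∈ MulAction.orbit G m := by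
  rw [← MulAction.orbit_eq_iff, ← MulAction.orbit_eq_iff]
  have : MulAction.orbit G (g n) = MulAction.orbit G n := MulAction.orbit_smul (⟨g, hg⟩ : G) n
  rw [this]

/-! ## Strict convexity -/

/-- No point of `Y` is the midpoint of a nontrivial segment inside the ball on whose boundary
it lies. -/
def HasExtremeSpheres (Y : Type*) [NormedAddCommGroup Y] : Prop :=
  ∀ y h : Y, ‖y + h‖ ≤ ‖y‖ → ‖y - h‖ ≤ ‖y‖ → h = 0

theorem StrictConvexSpace.hasExtremeSpheres (Y : Type*) [NormedAddCommGroup Y] [NormedSpace ℝ Y]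
    [StrictConvexSpace ℝ Y] : HasExtremeSpheres Y := by
  intro y h h1 h2
  have h3 : (y + h) + (y - h) = (2 : ℝ) • y := by rw [two_smul]; abel
  have h4 : 2 * ‖y‖ ≤ ‖y + h‖ + ‖y - h‖ := by
    have := norm_add_le (y + h) (y - h)
    rwa [h3, norm_smul, Real.norm_ofNat] at this
  -- Both norms are at most `‖y‖` and their sum is at least `2‖y‖`, so both equal `‖y‖`.
  have h5 : ‖y + h‖ = ‖y - h‖ := by linarith
  by_contra hne
  have hne' : y + h ≠ y - h := fun heq => hne <| by
    have h6 : (2 : ℝ) • h = 0 := by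
      rw [two_smul, ← sub_eq_zero.2 heq]; abel
    simpa using h6
  have h7 := (norm_midpoint_lt_iff h5).2 hne'
  rw [h3, smul_smul] at h7
  norm_num at h7
  linarith

theorem IsStrictlyConvex.hasExtremeSpheres {𝕜 : Type*} [RCLike 𝕜] {Y : Type*}
    [NormedAddCommGroup Y] [NormedSpace 𝕜 Y] (hY : IsStrictlyConvex 𝕜 Y) :
    HasExtremeSpheres Y :=
  letI : NormedSpace ℝ Y := NormedSpace.restrictScalars ℝ 𝕜 Y
  haveI : StrictConvexSpace ℝ Y := hY
  StrictConvexSpace.hasExtremeSpheres Y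

/-- If `‖y + h‖` and `‖y - h‖` differ, strict convexity of `t ↦ t ^ p` gives the gap; if they agree,
extremality forces the common value above `‖y‖`. -/
theorem HasExtremeSpheres.two_mul_rpow_lt {E : Type*} [NormedAddCommGroup E] [NormedSpace ℝ E]
    (hE : HasExtremeSpheres E) {p : ℝ} (hp : 1 < p) (y : E) {h : E} (hh : h ≠ 0) :
    2 * ‖y‖ ^ p < ‖y + h‖ ^ p + ‖y - h‖ ^ p := by
  have h3 : (y + h) + (y - h) = (2 : ℝ) • y := by rw [two_smul]; abel
  have h4 : 2 * ‖y‖ ≤ ‖y + h‖ + ‖y - h‖ := by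
    have := norm_add_le (y + h) (y - h)
    rwa [h3, norm_smul, Real.norm_ofNat] at this
  have hp0 : 0 < p := by linarith
  have key : ‖y‖ ^ p ≤ ((‖y + h‖ + ‖y - h‖) / 2) ^ p :=
    Real.rpow_le_rpow (norm_nonneg _) (by linarith) hp0.le
  by_cases heq : ‖y + h‖ = ‖y - h‖
  · rw [← heq]
    have h5 : ‖y‖ < ‖y + h‖ := by
      by_contra hle
      push Not at hle
      exact hh (hE y h hle (heq ▸ hle))
    have := Real.rpow_lt_rpow (norm_nonneg _) h5 hp0
    linarith
  · have := (strictConvexOn_rpow hp).2 (mem_Ici.2 (norm_nonneg (y + h)))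
      (mem_Ici.2 (norm_nonneg (y - h))) heq
      (by norm_num : (0 : ℝ) < 1 / 2) (by norm_num : (0 : ℝ) < 1 / 2) (by norm_num)
    simp only [smul_eq_mul] at this
    rw [show 1 / 2 * ‖y + h‖ + 1 / 2 * ‖y - h‖ = (‖y + h‖ + ‖y - h‖) / 2 by ring] at this
    linarith

/-- The `p`-th powers are summed coordinatewise: one coordinate with `h i ≠ 0` makes the total
strict, against the two norm bounds. -/
theorem lp.hasExtremeSpheres {ι : Type*} {E : Type*} [NormedAddCommGroup E] [NormedSpace ℝ E]
    (hE : HasExtremeSpheres E) (p : ℝ≥0∞) [Fact (1 ≤ p)] (hp : 1 < p) (hp' : p < ∞) :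
    HasExtremeSpheres (lp (fun _ : ι => E) p) := by
  have hr : 1 < p.toReal := by
    rw [← ENNReal.toReal_one]
    exact (ENNReal.toReal_lt_toReal ENNReal.one_ne_top hp'.ne).2 hp
  have hr0 : 0 < p.toReal := by linarith
  intro y h h1 h2
  by_contra hne
  obtain ⟨i, hi⟩ : ∃ i, h i ≠ 0 := by
    by_contra hall
    push Not at hall
    exact hne (lp.ext (funext hall))
  have s0 := lp.hasSum_norm hr0 y
  have s1 := lp.hasSum_norm hr0 (y + h)
  have s2 := lp.hasSum_norm hr0 (y - h)
  have hle : ∀ j, 2 * ‖y j‖ ^ p.toReal ≤ ‖(y + h) j‖ ^ p.toReal + ‖(y - h) j‖ ^ p.toReal := by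
    intro j
    by_cases hj : h j = 0
    · simp [hj, two_mul]
    · exact (hE.two_mul_rpow_lt hr (y j) hj).le
  have hlt := hasSum_lt hle (hE.two_mul_rpow_lt hr (y i) hi) (s0.mul_left 2) (s1.add s2)
  have e1 := Real.rpow_le_rpow (norm_nonneg _) h1 hr0.le
  have e2 := Real.rpow_le_rpow (norm_nonneg _) h2 hr0.le
  linarith

/-! ## Norm-attaining and invariant operators -/

section Operators

variable {𝕜 : Type*} [RCLike 𝕜] {X : Type*} [NormedAddCommGroup X] [NormedSpace 𝕜 X]
  {Y : Type*} [NormedAddCommGroup Y] [NormedSpace 𝕜 Y]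

/-- A point inside the open ball can satisfy the bound only if `T = 0`; then any unit vector serves,
and `e` guarantees that there is one. -/
theorem isNormAttaining_of_le {e : X} (he : e ≠ 0) {T : X →L[𝕜] Y} {x : X} (hx : ‖x‖ ≤ 1)
    (hT : ‖T‖ ≤ ‖T x‖) : IsNormAttaining T := by
  by_cases h0 : T = 0
  · exact ⟨((‖e‖⁻¹ : ℝ) : 𝕜) • e, by simp [norm_smul, he], by simp [h0]⟩
  · have hpos : 0 < ‖T‖ := norm_pos_iff.2 h0
    have h1 := T.le_opNorm x
    refine ⟨x, le_antisymm hx ?_, le_antisymm ?_ hT⟩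
    · by_contra hlt
      nlinarith
    · nlinarith

/-- If an operator attains its norm at `x`, it vanishes in each direction in which `x` can be moved
both ways inside the unit ball. -/
theorem HasExtremeSpheres.apply_eq_zero (hY : HasExtremeSpheres Y) {T : X →L[𝕜] Y} {x h : X}
    (hT : ‖T x‖ = ‖T‖) (h1 : ‖x + h‖ ≤ 1) (h2 : ‖x - h‖ ≤ 1) : T h = 0 := by
  refine hY (T x) (T h) ?_ ?_
  · rw [← map_add, hT]
    exact T.unit_le_opNorm _ h1
  · rw [← map_sub, hT]
    exact T.unit_le_opNorm _ h2

theorem ContinuousLinearMap.apply_eq_zero_of_smul {T : X →L[𝕜] Y} {x : X} {c : 𝕜} (hc : c ≠ 0)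
    (h : T (c • x) = 0) : T x = 0 := by
  rw [map_smul] at h
  exact (smul_eq_zero.1 h).resolve_left hc

variable {coord : X →ₗ[𝕜] ℕ → 𝕜}

/-- The operator `x ↦ (∑ n ∈ O, x n) • v`. -/
noncomputable def sumSMul (hcoord : ∀ n, Continuous fun x => coord x n)
    (O : Finset ℕ) (v : Y) : X →L[𝕜] Y :=
  (∑ n ∈ O, (⟨(LinearMap.proj n).comp coord, hcoord n⟩ : X →L[𝕜] 𝕜)).smulRight v

theorem sumSMul_apply (hcoord : ∀ n, Continuous fun x => coord x n)
    (O : Finset ℕ) (v : Y) (x : X) :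
    sumSMul hcoord O v x = (∑ n ∈ O, coord x n) • v := by
  simp [sumSMul, _root_.sum_apply]
  rfl

theorem sumSMul_mem_invariantOperators (hcoord : ∀ n, Continuous fun x => coord x n)
    {G : Subgroup (Equiv.Perm ℕ)} {O : Finset ℕ}
    (hO : ∀ g ∈ G, ∀ n, g n ∈ O ↔ n ∈ O) (v : Y) :
    sumSMul hcoord O v ∈ invariantOperators Y coord G := by
  intro g hg x y hxy
  rw [sumSMul_apply, sumSMul_apply]
  congr 1
  symm
  exact Finset.sum_equiv g (fun n => (hO g hg n).symm) fun n _ => (hxy n).symm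

variable {e : ℕ → X}

theorem isPermutedBy_unit (he : ∀ n, coord (e n) = Pi.single n 1) (g : Equiv.Perm ℕ) (n : ℕ) :
    IsPermutedBy coord g (e n) (e (g n)) := by
  intro m
  rw [he, he]
  simp [Pi.single_apply]

theorem apply_unit_perm (he : ∀ n, coord (e n) = Pi.single n 1) {G : Subgroup (Equiv.Perm ℕ)}
    {T : X →L[𝕜] Y} (hT : T ∈ invariantOperators Y coord G) {g : Equiv.Perm ℕ} (hg : g ∈ G)
    (n : ℕ) : T (e (g n)) = T (e n) :=
  hT g hg _ _ (isPermutedBy_unit he g n)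

theorem sumSMul_unit (hcoord : ∀ n, Continuous fun x => coord x n)
    (he : ∀ n, coord (e n) = Pi.single n 1) (O : Finset ℕ) (v : Y) (n : ℕ) :
    sumSMul hcoord O v (e n) = if n ∈ O then v else 0 := by
  rw [sumSMul_apply, he]
  simp [Pi.single_apply]

/-- If the closure of the norm-attaining invariant operators is the closure of a subspace that
contains the operators `sumSMul`, the remaining invariant operators are not spaceable. -/
theorem not_isPairSpaceable_nonApproximable (hcoord : ∀ n, Continuous fun x => coord x n)
    {G : Subgroup (Equiv.Perm ℕ)} (hG : 0 < permInfty G)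
    (he : ∀ n, coord (e n) = Pi.single n 1) [Nontrivial Y]
    (S : Submodule 𝕜 (invariantOperators Y coord G))
    (hS : ∀ (T : invariantOperators Y coord G) (N : ℕ),
      (∀ n, N ≤ n → (T : X →L[𝕜] Y) (e n) = 0) → T ∈ S)
    (hNA : ∀ T : invariantOperators Y coord G, IsNormAttaining (T : X →L[𝕜] Y) → T ∈ S)
    (hcl : ∀ T ∈ S, T ∈ closure {T : invariantOperators Y coord G |
      IsNormAttaining (T : X →L[𝕜] Y)})
    {α β : Cardinal.{v}} (hα : ℵ₀ ≤ α) :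
    ¬ IsPairSpaceable 𝕜 (nonApproximable Y coord G) α β := by
  have heq : nonApproximable Y coord G =
      ((S.topologicalClosure : Set (invariantOperators Y coord G)))ᶜ := by
    rw [nonApproximable, Submodule.topologicalClosure_coe]
    congr 1
    -- `S` lies between the norm-attaining operators and their closure, so both have the same
    -- closure, which is therefore a subspace.
    exact (closure_mono hNA).antisymm (closure_minimal hcl isClosed_closure)
  obtain ⟨n, hn⟩ := exists_finite_orbit_of_permInfty_pos hG
  obtain ⟨v, hv⟩ := exists_ne (0 : Y)
  let b : invariantOperators Y coord G := ⟨sumSMul hcoord hn.toFinset v,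
    sumSMul_mem_invariantOperators hcoord (fun g hg m => by
      simpa using apply_mem_orbit_iff hg n m) v⟩
  have hb : ∀ m, (b : X →L[𝕜] Y) (e m) = if m ∈ hn.toFinset then v else 0 :=
    sumSMul_unit hcoord he _ v
  rw [heq]
  refine not_isPairSpaceable_compl (𝕜 := 𝕜) (V := invariantOperators Y coord G)
    S.topologicalClosure (b := b) ?_ ?_ hα
  · obtain ⟨N, hN⟩ := hn.bddAbove
    refine S.le_topologicalClosure <| hS b (N + 1) fun m hm => ?_
    rw [hb, if_neg]
    intro hmem
    have := hN (hn.mem_toFinset.1 hmem)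
    omega
  · intro h0
    have h1 := hb n
    rw [h0, if_pos (hn.mem_toFinset.2 (MulAction.mem_orbit_self n))] at h1
    exact hv (by simpa using h1.symm)

end Operators

/-! ## Operators on `d_*(w, 1)` -/

section Weights

variable (w : Weight)

theorem Weight.partialSum_succ (k : ℕ) : w.partialSum (k + 1) = w.partialSum k + w.val k :=
  Finset.sum_range_succ _ _

theorem Weight.partialSum_mono : Monotone w.partialSum :=
  monotone_nat_of_le_succ fun k => by
    rw [w.partialSum_succ]
    linarith [w.pos k]

theorem Weight.partialSum_pos {k : ℕ} (hk : 0 < k) : 0 < w.partialSum k :=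
  Finset.sum_pos (fun i _ => w.pos i) (Finset.nonempty_range_iff.2 hk.ne')

theorem Weight.val_zero_le_partialSum {k : ℕ} (hk : 0 < k) : w.val 0 ≤ w.partialSum k := by
  have h := w.partialSum_mono (Nat.succ_le_of_lt hk)
  simpa [Weight.partialSum] using h

theorem Weight.tendsto_partialSum : Tendsto w.partialSum atTop atTop :=
  (not_summable_iff_tendsto_nat_atTop_of_nonneg fun n => (w.pos n).le).1 w.not_summable

end Weights

namespace DStar

variable {𝕜 : Type*} [RCLike 𝕜] {w : Weight}

theorem lorentzRatio_le_norm (x : DStar 𝕜 w) (k : ℕ) : lorentzRatio w (coord 𝕜 w x) k ≤ ‖x‖ := by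
  rcases k with _ | k
  · simp [lorentzRatio, rearrangementSum]
  · exact le_ciSup (bddAbove_ratio x) k

theorem sum_norm_le_ratio_mul (x : DStar 𝕜 w) (E : Finset ℕ) :
    ∑ n ∈ E, ‖coord 𝕜 w x n‖ ≤ lorentzRatio w (coord 𝕜 w x) E.card * w.partialSum E.card := by
  rcases E.eq_empty_or_nonempty with rfl | hE
  · simp [Weight.partialSum]
  · rw [lorentzRatio, div_mul_cancel₀ _ (w.partialSum_pos hE.card_pos).ne']
    exact sum_le_rearrangementSum (coord_tendsto x) E

theorem sum_norm_le (x : DStar 𝕜 w) (E : Finset ℕ) :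
    ∑ n ∈ E, ‖coord 𝕜 w x n‖ ≤ ‖x‖ * w.partialSum E.card :=
  (sum_norm_le_ratio_mul x E).trans
    (mul_le_mul_of_nonneg_right (lorentzRatio_le_norm x _) (w.partialSum_nonneg _))

/-- The top `k` terms of the rearrangement are the terms over some `k`-element set, so the norm is
controlled by sums over finite sets. Together with `sum_norm_le` this replaces rearrangements in the
estimates below. -/
theorem norm_le_of_sum_norm_le {x : DStar 𝕜 w} {c : ℝ}
    (h : ∀ E : Finset ℕ, E.Nonempty → ∑ n ∈ E, ‖coord 𝕜 w x n‖ ≤ c * w.partialSum E.card) :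
    ‖x‖ ≤ c := by
  rw [norm_def]
  refine ciSup_le fun k => ?_
  obtain ⟨F, hF, -, hs⟩ := exists_top_indices (coord_tendsto x) (k + 1)
  rw [lorentzRatio, div_le_iff₀ (w.partialSum_pos (Nat.add_one_pos k)), ← hs, ← hF]
  exact h F (Finset.card_pos.1 (by omega))

theorem norm_coord_le (x : DStar 𝕜 w) (n : ℕ) : ‖coord 𝕜 w x n‖ ≤ w.val 0 * ‖x‖ := by
  have := sum_norm_le x {n}
  simpa [Weight.partialSum, mul_comm] using this

theorem continuous_coord (n : ℕ) : Continuous fun x : DStar 𝕜 w => coord 𝕜 w x n :=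
  (LinearMap.mkContinuous ((LinearMap.proj n).comp (coord 𝕜 w)) (w.val 0)
    fun x => norm_coord_le x n).continuous

variable (𝕜 w) in
/-- The unit vector `e_n` of `d_*(w, 1)`. -/
noncomputable def unit (n : ℕ) : DStar 𝕜 w :=
  ⟨Pi.single n 1, by
    have h0 : Tendsto (Pi.single n 1 : ℕ → 𝕜) atTop (𝓝 0) := by
      refine tendsto_const_nhds.congr' ?_
      filter_upwards [eventually_gt_atTop n] with m hm
      rw [Pi.single_eq_of_ne hm.ne']
    refine ⟨h0, squeeze_zero (g := fun k => 1 / w.partialSum k) (fun k => ?_) (fun k => ?_) ?_⟩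
    · exact div_nonneg (rearrangementSum_nonneg _ _) (w.partialSum_nonneg k)
    · obtain ⟨F, -, -, hs⟩ := exists_top_indices h0 k
      refine div_le_div_of_nonneg_right ?_ (w.partialSum_nonneg k)
      rw [← hs]
      have : ∀ m, ‖(Pi.single n 1 : ℕ → 𝕜) m‖ = if m = n then 1 else 0 := fun m => by
        rw [Pi.single_apply]
        split_ifs <;> simp
      simp only [this, Finset.sum_ite_eq']
      split_ifs <;> norm_num
    · simp only [one_div]
      exact w.tendsto_partialSum.inv_tendsto_atTop⟩

theorem coord_unit (n : ℕ) : coord 𝕜 w (unit 𝕜 w n) = Pi.single n 1 := rfl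

theorem unit_ne_zero (n : ℕ) : unit 𝕜 w n ≠ 0 := fun h => by
  have := congrFun (coord_unit (𝕜 := 𝕜) (w := w) n) n
  rw [h] at this
  simp at this

/-- The sequence `x` truncated after `N` terms. -/
noncomputable def trunc (N : ℕ) (x : DStar 𝕜 w) : DStar 𝕜 w :=
  ∑ n ∈ Finset.range N, coord 𝕜 w x n • unit 𝕜 w n

theorem coord_trunc (N : ℕ) (x : DStar 𝕜 w) (m : ℕ) :
    coord 𝕜 w (trunc N x) m = if m < N then coord 𝕜 w x m else 0 := by
  simp [trunc, coord_unit, Pi.single_apply]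

theorem norm_trunc_le (N : ℕ) (x : DStar 𝕜 w) : ‖trunc N x‖ ≤ ‖x‖ := by
  refine norm_le_of_sum_norm_le fun E _ => le_trans (Finset.sum_le_sum fun m _ => ?_)
    (sum_norm_le x E)
  rw [coord_trunc]
  split_ifs
  · exact le_rfl
  · simp

theorem tendsto_trunc (x : DStar 𝕜 w) : Tendsto (fun N => trunc N x) atTop (𝓝 x) := by
  rw [tendsto_iff_norm_sub_tendsto_zero, Metric.tendsto_atTop]
  intro ε hε
  obtain ⟨K, hK⟩ := (Metric.tendsto_atTop.1 x.2.2) (ε / 2) (half_pos hε)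
  have hw := w.pos 0
  -- Sets with at least `K` elements are handled by the decay of the ratio. Smaller sets have fewer
  -- than `K` terms, each small enough that together they stay below `ε / 2 * w.val 0`.
  obtain ⟨N₀, hN₀⟩ := (Metric.tendsto_atTop.1 (coord_tendsto x)) (ε / 2 * w.val 0 / (K + 1))
    (by positivity)
  refine ⟨N₀, fun N hN => ?_⟩
  rw [Real.dist_eq, sub_zero, abs_norm]
  refine lt_of_le_of_lt (norm_le_of_sum_norm_le (c := ε / 2) fun E hE => ?_) (half_lt_self hε)
  have hc : ∀ m, coord 𝕜 w (trunc N x - x) m = if m < N then 0 else -coord 𝕜 w x m := fun m => by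
    rw [map_sub, Pi.sub_apply, coord_trunc]
    split_ifs <;> simp
  rcases le_or_gt K E.card with hKE | hKE
  · refine le_trans (Finset.sum_le_sum fun m _ => ?_) ((sum_norm_le_ratio_mul x E).trans
      (mul_le_mul_of_nonneg_right ?_ (w.partialSum_nonneg _)))
    · rw [hc]
      split_ifs <;> simp
    · have := hK _ hKE
      rw [Real.dist_eq, sub_zero] at this
      exact (le_abs_self _).trans this.le
  · have h1 : ∑ m ∈ E, ‖coord 𝕜 w (trunc N x - x) m‖ ≤
        E.card • (ε / 2 * w.val 0 / (K + 1)) := by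
      refine Finset.sum_le_card_nsmul _ _ _ fun m _ => ?_
      rw [hc]
      split_ifs with h
      · rw [norm_zero]
        positivity
      · rw [norm_neg]
        have := hN₀ m (by omega)
        rw [dist_zero_right] at this
        exact this.le
    refine h1.trans ?_
    have h2 : (E.card : ℝ) ≤ K := by exact_mod_cast hKE.le
    have h3 := w.val_zero_le_partialSum hE.card_pos
    calc E.card • (ε / 2 * w.val 0 / (K + 1))
        = (E.card / (K + 1)) * (ε / 2 * w.val 0) := by rw [nsmul_eq_mul]; ring
      _ ≤ 1 * (ε / 2 * w.val 0) := by
          refine mul_le_mul_of_nonneg_right ?_ (by positivity)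
          rw [div_le_one (by positivity)]
          linarith
      _ ≤ ε / 2 * w.partialSum E.card := by
          rw [one_mul]
          exact mul_le_mul_of_nonneg_left h3 (by positivity)

/-- A point of the unit ball stays in the unit ball when its far coordinates are changed by a
small amount, which can be chosen uniformly. -/
theorem exists_norm_add_unit_le (x : DStar 𝕜 w) (hx : ‖x‖ ≤ 1) :
    ∃ δ > 0, ∃ N : ℕ, ∀ m ≥ N, ∀ c : 𝕜, ‖c‖ ≤ δ → ‖x + c • unit 𝕜 w m‖ ≤ 1 := by
  have hw := w.pos 0
  obtain ⟨K, hK⟩ := (Metric.tendsto_atTop.1 x.2.2) (1 / 2) one_half_pos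
  obtain ⟨F, hFK, hF, -⟩ := exists_top_indices (coord_tendsto x) K
  obtain ⟨ρ, hρ, hρF⟩ : ∃ ρ > 0, ∀ j ∈ F, coord 𝕜 w x j ≠ 0 → ρ ≤ ‖coord 𝕜 w x j‖ := by
    have h : ∀ᶠ ρ in 𝓝[>] (0 : ℝ), ∀ j ∈ F, coord 𝕜 w x j ≠ 0 → ρ ≤ ‖coord 𝕜 w x j‖ := by
      rw [Finset.eventually_all]
      intro j _
      by_cases hj : coord 𝕜 w x j = 0
      · simp [hj]
      · filter_upwards [nhdsWithin_le_nhds (eventually_le_nhds (norm_pos_iff.2 hj))] with ρ hρ _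
        exact hρ
    obtain ⟨ρ, h, hρ⟩ := (h.and self_mem_nhdsWithin).exists
    exact ⟨ρ, hρ, h⟩
  obtain ⟨N₀, hN₀⟩ := (Metric.tendsto_atTop.1 (coord_tendsto x)) (ρ / 2) (half_pos hρ)
  obtain ⟨N₁, hN₁⟩ := F.bddAbove
  -- One bound for each case below: exchanging `m` for a larger coordinate of `F`, the slack half of
  -- the partial sum for large sets, and the next weight when `x` has run out of nonzero terms.
  refine ⟨min (ρ / 2) (min (w.val 0 / 2) (w.val K)),
    lt_min (half_pos hρ) (lt_min (half_pos hw) (w.pos K)), max N₀ (N₁ + 1), fun m hm c hc => ?_⟩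
  have hmF : m ∉ F := fun h => by
    have := hN₁ h
    have := (le_max_right _ _).trans hm
    omega
  have hmρ := hN₀ m ((le_max_left _ _).trans hm)
  rw [dist_zero_right] at hmρ
  obtain ⟨hc1, hc2⟩ := le_min_iff.1 hc
  obtain ⟨hc2, hc3⟩ := le_min_iff.1 hc2
  have hx1 : ∀ E : Finset ℕ, ∑ n ∈ E, ‖coord 𝕜 w x n‖ ≤ w.partialSum E.card := fun E =>
    (sum_norm_le x E).trans (mul_le_of_le_one_left (w.partialSum_nonneg _) hx)
  have hco : ∀ n ≠ m, coord 𝕜 w (x + c • unit 𝕜 w m) n = coord 𝕜 w x n := fun n hn => by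
    simp [coord_unit, Pi.single_eq_of_ne hn]
  have hcm : ‖coord 𝕜 w (x + c • unit 𝕜 w m) m‖ ≤ ‖coord 𝕜 w x m‖ + ‖c‖ := by
    simpa [coord_unit] using norm_add_le (coord 𝕜 w x m) c
  refine norm_le_of_sum_norm_le fun E hE => ?_
  rw [one_mul]
  by_cases hmE : m ∈ E
  · have hsum : ∑ n ∈ E, ‖coord 𝕜 w (x + c • unit 𝕜 w m) n‖ ≤
        ∑ n ∈ E.erase m, ‖coord 𝕜 w x n‖ + (‖coord 𝕜 w x m‖ + ‖c‖) := by
      rw [← Finset.sum_erase_add _ _ hmE]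
      refine add_le_add (le_of_eq (Finset.sum_congr rfl fun n hn => ?_)) hcm
      rw [hco n (Finset.ne_of_mem_erase hn)]
    refine hsum.trans ?_
    rcases le_or_gt K E.card with hKE | hKE
    · rw [← add_assoc, Finset.sum_erase_add E (fun n => ‖coord 𝕜 w x n‖) hmE]
      have h1 := hK _ hKE
      rw [Real.dist_eq, sub_zero] at h1
      have h2 := (sum_norm_le_ratio_mul x E).trans (mul_le_mul_of_nonneg_right
        ((le_abs_self _).trans h1.le) (w.partialSum_nonneg _))
      have h3 := w.val_zero_le_partialSum hE.card_pos
      linarith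
    -- `E` is too small to contain `F`. If `x j ≠ 0`, then `|x m| + |c| ≤ ρ ≤ |x j|`, so replacing
    -- `m` by `j` does not lower the sum. If `x j = 0`, maximality of `F` gives `x m = 0`, and `|c|`
    -- fits under the last weight.
    · obtain ⟨j, hjF, hjE⟩ : ∃ j ∈ F, j ∉ E := by
        by_contra hall
        push Not at hall
        have := Finset.card_le_card (show F ⊆ E from hall)
        omega
      have hjm : j ∉ E.erase m := fun h => hjE (Finset.mem_of_mem_erase h)
      have hcard := Finset.card_erase_add_one hmE
      by_cases hj0 : coord 𝕜 w x j = 0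
      · have h1 := hF j hjF m hmF
        rw [hj0, norm_zero] at h1
        have h2 := hx1 (E.erase m)
        have h3 : w.val K ≤ w.val (E.erase m).card := w.antitone (by omega)
        rw [← hcard, w.partialSum_succ]
        linarith
      · have h1 := hρF j hjF hj0
        have h2 := hx1 (insert j (E.erase m))
        rw [Finset.sum_insert hjm, Finset.card_insert_of_notMem hjm, hcard] at h2
        linarith
  · rw [Finset.sum_congr rfl fun n hn => by rw [hco n (fun h => hmE (h ▸ hn))]]
    exact hx1 E

variable {Y : Type*} [NormedAddCommGroup Y] [NormedSpace 𝕜 Y]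

/-- A norm-attaining operator from `d_*(w, 1)` into a strictly convex space depends on finitely
many coordinates only. -/
theorem eventually_apply_unit_eq_zero (hY : HasExtremeSpheres Y) {T : DStar 𝕜 w →L[𝕜] Y}
    (hT : IsNormAttaining T) : ∃ N, ∀ n, N ≤ n → T (unit 𝕜 w n) = 0 := by
  obtain ⟨x, hx, hTx⟩ := hT
  obtain ⟨δ, hδ, N, hN⟩ := exists_norm_add_unit_le x hx.le
  have hδ' : ‖(δ : 𝕜)‖ = δ := by rw [RCLike.norm_ofReal, abs_of_pos hδ]
  refine ⟨N, fun m hm => T.apply_eq_zero_of_smul (c := (δ : 𝕜)) (by exact_mod_cast hδ.ne')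
    (hY.apply_eq_zero hTx (hN m hm _ hδ'.le) ?_)⟩
  rw [sub_eq_add_neg, ← neg_smul]
  exact hN m hm _ (by rw [norm_neg, hδ'])

/-- An operator that depends on finitely many coordinates only attains its norm. -/
theorem isNormAttaining_of_apply_unit_eq_zero {T : DStar 𝕜 w →L[𝕜] Y} {N : ℕ}
    (hT : ∀ n, N ≤ n → T (unit 𝕜 w n) = 0) : IsNormAttaining T := by
  -- `T` factors through a norm-one truncation, so its norm is the maximum over a compact
  -- finite-dimensional ball.
  have htr : ∀ x, T x = T (trunc N x) := fun x => by
    refine tendsto_nhds_unique ((T.continuous.tendsto x).comp (tendsto_trunc x))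
      (tendsto_const_nhds.congr' ?_)
    filter_upwards [eventually_ge_atTop N] with M hM
    simp only [Function.comp, trunc, map_sum, map_smul]
    refine Finset.sum_subset (Finset.range_subset_range.2 hM) fun n _ hn => ?_
    rw [hT n (by simpa using hn), smul_zero]
  let E : Submodule 𝕜 (DStar 𝕜 w) := Submodule.span 𝕜 (unit 𝕜 w '' (Set.Iio N))
  have : FiniteDimensional 𝕜 E := FiniteDimensional.span_of_finite 𝕜 ((finite_Iio N).image _)
  have : ProperSpace E := FiniteDimensional.proper 𝕜 E
  have hmem : ∀ x, trunc N x ∈ E := fun x => Submodule.sum_mem _ fun n hn =>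
    E.smul_mem _ (Submodule.subset_span ⟨n, by simpa using hn, rfl⟩)
  obtain ⟨x₀, hx₀, hmax⟩ := (isCompact_closedBall (0 : E) 1).exists_isMaxOn ⟨0, by simp⟩
    (f := fun x : E => ‖T x‖) (by fun_prop)
  refine isNormAttaining_of_le (unit_ne_zero 0) (x := x₀) (by simpa using hx₀)
    (ContinuousLinearMap.opNorm_le_of_unit_norm (norm_nonneg _) fun x hx => ?_)
  rw [htr]
  exact hmax (a := ⟨trunc N x, hmem x⟩) (by simpa using! (norm_trunc_le N x).trans hx.le)

/-- The `G`-invariant operators that depend on finitely many coordinates only. -/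
noncomputable def finitelySupported (Y : Type*) [NormedAddCommGroup Y] [NormedSpace 𝕜 Y]
    (G : Subgroup (Equiv.Perm ℕ)) : Submodule 𝕜 (invariantOperators Y (coord 𝕜 w) G) where
  carrier := {T | ∃ N, ∀ n, N ≤ n → (T : DStar 𝕜 w →L[𝕜] Y) (unit 𝕜 w n) = 0}
  zero_mem' := ⟨0, fun n _ => by simp⟩
  add_mem' := by
    rintro S T ⟨M, hM⟩ ⟨N, hN⟩
    refine ⟨max M N, fun n hn => ?_⟩
    simp [hM n (le_of_max_le_left hn), hN n (le_of_max_le_right hn)]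
  smul_mem' := by
    rintro c T ⟨N, hN⟩
    exact ⟨N, fun n hn => by simp [hN n hn]⟩

theorem not_isPairSpaceable (hY : HasExtremeSpheres Y) [Nontrivial Y]
    {G : Subgroup (Equiv.Perm ℕ)} (hG : 0 < permInfty G) {α β : Cardinal.{v}} (hα : ℵ₀ ≤ α) :
    ¬ IsPairSpaceable 𝕜 (nonApproximable Y (coord 𝕜 w) G) α β :=
  not_isPairSpaceable_nonApproximable continuous_coord hG coord_unit (finitelySupported Y G)
    (fun _ N hN => ⟨N, hN⟩) (fun _ hT => eventually_apply_unit_eq_zero hY hT)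
    (fun _ ⟨_, hN⟩ => subset_closure (isNormAttaining_of_apply_unit_eq_zero hN)) hα

end DStar

/-! ## The norm of `X(w)` -/

theorem Weight.val_lt_one {w : Weight} (hw : w.val 0 < 1) (n : ℕ) : w.val n < 1 :=
  (w.antitone n.zero_le).trans_lt hw

namespace ZSpace

variable {𝕜 : Type*} [RCLike 𝕜] {w : Weight}

theorem coord_single (n : ℕ) : coord 𝕜 w (single 𝕜 w n) = Pi.single n 1 := rfl

theorem coord_sum_single (F : Finset ℕ) (c : ℕ → 𝕜) (m : ℕ) :
    coord 𝕜 w (∑ n ∈ F, c n • single 𝕜 w n) m = if m ∈ F then c m else 0 := by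
  simp [coord_single, Pi.single_apply]

theorem norm_le_of_norm_coord_le {z z' : ZSpace 𝕜 w}
    (h : ∀ n, ‖coord 𝕜 w z n‖ ≤ ‖coord 𝕜 w z' n‖) : ‖z‖ ≤ ‖z'‖ :=
  add_le_add
    (ciSup_mono (bddAbove z') fun n => mul_le_mul_of_nonneg_left (h n) (abs_nonneg _))
    ((summable z).tsum_le_tsum (fun n => mul_le_mul_of_nonneg_left (h n) (w.pos n).le)
      (summable z'))

theorem one_sub_mul_norm_coord_le (z : ZSpace 𝕜 w) (n : ℕ) :
    (1 - w.val n) * ‖coord 𝕜 w z n‖ ≤ ⨆ n, |1 - w.val n| * ‖coord 𝕜 w z n‖ :=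
  (mul_le_mul_of_nonneg_right (le_abs_self _) (norm_nonneg _)).trans (le_ciSup (bddAbove z) n)

theorem norm_sum_single_le (hw : w.val 0 < 1) (F : Finset ℕ) (c : ℕ → 𝕜) {a : ℝ} (ha : 0 ≤ a)
    (hc : ∀ n ∈ F, (1 - w.val n) * ‖c n‖ ≤ a) :
    ‖∑ n ∈ F, c n • single 𝕜 w n‖ ≤ a + ∑ n ∈ F, w.val n * ‖c n‖ := by
  rw [norm_def]
  refine add_le_add (ciSup_le fun n => ?_) (le_of_eq ?_)
  · rw [coord_sum_single, abs_of_pos (sub_pos.2 (Weight.val_lt_one hw n))]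
    split_ifs with h
    · exact hc n h
    · simpa using ha
  · rw [tsum_eq_sum (s := F)]
    · exact Finset.sum_congr rfl fun n hn => by rw [coord_sum_single, if_pos hn]
    · intro n hn
      rw [coord_sum_single, if_neg hn, norm_zero, mul_zero]

/-- The sequence `z` truncated after `N` terms. -/
noncomputable def trunc (N : ℕ) (z : ZSpace 𝕜 w) : ZSpace 𝕜 w :=
  ∑ n ∈ Finset.range N, coord 𝕜 w z n • single 𝕜 w n

theorem norm_trunc_le (N : ℕ) (z : ZSpace 𝕜 w) : ‖trunc N z‖ ≤ ‖z‖ :=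
  norm_le_of_norm_coord_le fun n => by
    rw [trunc, coord_sum_single]
    split_ifs <;> simp

end ZSpace

namespace XSpace

variable {𝕜 : Type*} [RCLike 𝕜] {w : Weight}

instance : CompleteSpace (XSpace 𝕜 w) :=
  (Submodule.isClosed_topologicalClosure _).completeSpace_coe

theorem norm_toDual_apply_le (x : XSpace 𝕜 w) (z : ZSpace 𝕜 w) :
    ‖toDual 𝕜 w x z‖ ≤ ‖x‖ * ‖z‖ :=
  (toDual 𝕜 w x).le_opNorm z

theorem norm_le_of_toDual {x : XSpace 𝕜 w} {c : ℝ} (hc : 0 ≤ c)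
    (h : ∀ z, ‖toDual 𝕜 w x z‖ ≤ c * ‖z‖) : ‖x‖ ≤ c :=
  (toDual 𝕜 w x).opNorm_le_bound hc h

theorem coord_apply (x : XSpace 𝕜 w) (n : ℕ) :
    coord 𝕜 w x n = toDual 𝕜 w x (ZSpace.single 𝕜 w n) := rfl

theorem toDual_sum_single (x : XSpace 𝕜 w) (F : Finset ℕ) (c : ℕ → 𝕜) :
    toDual 𝕜 w x (∑ n ∈ F, c n • ZSpace.single 𝕜 w n) = ∑ n ∈ F, c n * coord 𝕜 w x n := by
  simp [coord_apply]

variable (𝕜 w) in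
/-- The coordinate functionals on `X(w)`. -/
noncomputable def coordFunctional (n : ℕ) : StrongDual 𝕜 (XSpace 𝕜 w) :=
  LinearMap.mkContinuous ((LinearMap.proj n).comp (coord 𝕜 w)) ‖ZSpace.single 𝕜 w n‖ fun x => by
    rw [mul_comm]
    exact norm_toDual_apply_le x _

theorem coordFunctional_apply (n : ℕ) (x : XSpace 𝕜 w) :
    coordFunctional 𝕜 w n x = coord 𝕜 w x n := rfl

theorem continuous_coord (n : ℕ) : Continuous fun x : XSpace 𝕜 w => coord 𝕜 w x n :=
  (coordFunctional 𝕜 w n).continuous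

variable (𝕜 w) in
/-- The unit vector `e_n` of `X(w)`. -/
noncomputable def unit (n : ℕ) : XSpace 𝕜 w :=
  ⟨ZSpace.evalAt 𝕜 w n,
    Submodule.le_topologicalClosure _ (Submodule.subset_span (mem_range_self n))⟩

theorem toDual_unit (n : ℕ) (z : ZSpace 𝕜 w) :
    toDual 𝕜 w (unit 𝕜 w n) z = ZSpace.coord 𝕜 w z n := rfl

theorem coord_unit (n : ℕ) : coord 𝕜 w (unit 𝕜 w n) = Pi.single n 1 := by
  funext m
  rw [coord_apply, toDual_unit, ZSpace.coord_single]
  simp [Pi.single_apply, eq_comm]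

theorem unit_ne_zero (n : ℕ) : unit 𝕜 w n ≠ 0 := fun h => by
  have := congrFun (coord_unit (𝕜 := 𝕜) (w := w) n) n
  rw [h] at this
  simp at this

theorem norm_unit_le (n : ℕ) : ‖unit 𝕜 w n‖ ≤ 1 :=
  norm_le_of_toDual zero_le_one fun z => by
    rw [toDual_unit, one_mul]
    exact ZSpace.norm_coord_le z n

/-- The sequence `x` truncated after `N` terms. -/
noncomputable def trunc (N : ℕ) : XSpace 𝕜 w →ₗ[𝕜] XSpace 𝕜 w where
  toFun x := ∑ n ∈ Finset.range N, coord 𝕜 w x n • unit 𝕜 w n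
  map_add' x y := by simp [add_smul, Finset.sum_add_distrib]
  map_smul' c x := by simp [Finset.smul_sum, mul_smul]

theorem trunc_apply (N : ℕ) (x : XSpace 𝕜 w) :
    trunc N x = ∑ n ∈ Finset.range N, coord 𝕜 w x n • unit 𝕜 w n := rfl

theorem coord_trunc (N : ℕ) (x : XSpace 𝕜 w) (m : ℕ) :
    coord 𝕜 w (trunc N x) m = if m < N then coord 𝕜 w x m else 0 := by
  simp [trunc_apply, coord_unit, Pi.single_apply]

theorem toDual_trunc (N : ℕ) (x : XSpace 𝕜 w) (z : ZSpace 𝕜 w) :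
    toDual 𝕜 w (trunc N x) z = toDual 𝕜 w x (ZSpace.trunc N z) := by
  rw [ZSpace.trunc, toDual_sum_single, trunc_apply, map_sum, sum_apply]
  refine Finset.sum_congr rfl fun n _ => ?_
  rw [map_smul, smul_apply, toDual_unit, smul_eq_mul, mul_comm]

theorem norm_trunc_le (N : ℕ) (x : XSpace 𝕜 w) : ‖trunc N x‖ ≤ ‖x‖ :=
  norm_le_of_toDual (norm_nonneg x) fun z => by
    rw [toDual_trunc]
    exact (norm_toDual_apply_le x _).trans
      (mul_le_mul_of_nonneg_left (ZSpace.norm_trunc_le N z) (norm_nonneg x))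

/-- Density of the span, known in `Z*` from the definition by closure, is moved to `X(w)` along the
isometric inclusion. -/
theorem exists_span_norm_sub_lt (x : XSpace 𝕜 w) {ε : ℝ} (hε : 0 < ε) :
    ∃ u ∈ Submodule.span 𝕜 (range (unit 𝕜 w)), ‖x - u‖ < ε := by
  have hx : (x.1 : StrongDual 𝕜 (ZSpace 𝕜 w)) ∈
      closure (Submodule.span 𝕜 (range (ZSpace.evalAt 𝕜 w)) : Set _) := x.2
  obtain ⟨f, hf, hd⟩ := Metric.mem_closure_iff.1 hx ε hε
  have hmap : (Submodule.span 𝕜 (range (unit 𝕜 w))).map (toDual 𝕜 w) =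
      Submodule.span 𝕜 (range (ZSpace.evalAt 𝕜 w)) := by
    rw [Submodule.map_span, ← range_comp]
    rfl
  rw [← hmap] at hf
  obtain ⟨u, hu, rfl⟩ := hf
  refine ⟨u, hu, ?_⟩
  rw [dist_eq_norm] at hd
  exact hd

theorem eventually_trunc_eq {u : XSpace 𝕜 w} (hu : u ∈ Submodule.span 𝕜 (range (unit 𝕜 w))) :
    ∀ᶠ N in atTop, trunc N u = u := by
  induction hu using Submodule.span_induction with
  | mem x hx =>
    obtain ⟨n, rfl⟩ := hx
    filter_upwards [eventually_gt_atTop n] with N hN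
    rw [trunc_apply, coord_unit, Finset.sum_eq_single_of_mem n (by simpa using hN)]
    · simp
    · intro m _ hm
      rw [Pi.single_eq_of_ne hm, zero_smul]
  | zero => simp
  | add x y _ _ hx hy =>
    filter_upwards [hx, hy] with N h1 h2
    rw [map_add, h1, h2]
  | smul c x _ hx =>
    filter_upwards [hx] with N h1
    rw [map_smul, h1]

/-- Truncations are contractions and are eventually the identity on each vector of the dense span.
-/
theorem tendsto_trunc (x : XSpace 𝕜 w) : Tendsto (fun N => trunc N x) atTop (𝓝 x) := by
  rw [Metric.tendsto_nhds]
  intro ε hε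
  obtain ⟨u, hu, hux⟩ := exists_span_norm_sub_lt x (half_pos hε)
  filter_upwards [eventually_trunc_eq hu] with N hN
  rw [dist_eq_norm]
  have h1 : trunc N x - x = trunc N (x - u) - (x - u) := by
    rw [map_sub, hN]
    abel
  rw [h1]
  have h2 := norm_trunc_le N (x - u)
  have h3 := norm_sub_le (trunc N (x - u)) (x - u)
  linarith

/-! ### The unit ball of `X(w)` in terms of excesses -/

variable (w) in
/-- The amount by which a coordinate of modulus `t` exceeds the weight `w n`, relative to
`1 - w n`. -/
noncomputable def excess (n : ℕ) (t : ℝ) : ℝ := max (t - w.val n) 0 / (1 - w.val n)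

theorem excess_nonneg (hw : w.val 0 < 1) (n : ℕ) (t : ℝ) : 0 ≤ excess w n t :=
  div_nonneg (le_max_right _ _) (sub_pos.2 (Weight.val_lt_one hw n)).le

theorem excess_of_le {n : ℕ} {t : ℝ} (h : t ≤ w.val n) : excess w n t = 0 := by
  rw [excess, max_eq_right (by linarith), zero_div]

theorem excess_of_ge {n : ℕ} {t : ℝ} (h : w.val n ≤ t) :
    excess w n t = (t - w.val n) / (1 - w.val n) := by
  rw [excess, max_eq_left (by linarith)]

theorem le_val_add_mul_excess (hw : w.val 0 < 1) (n : ℕ) (t : ℝ) :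
    t ≤ w.val n + (1 - w.val n) * excess w n t := by
  rw [excess, mul_div_cancel₀ _ (sub_pos.2 (Weight.val_lt_one hw n)).ne']
  linarith [le_max_left (t - w.val n) 0]

/-- Test `x` on the finite sequence with phases conjugate to those of `x` and moduli `1 / (1 - w_n)`
where `|x_n| > w_n`. The value is `∑ |x_n| / (1 - w_n)`, the norm is at most `1 + ∑ w_n / (1 -
w_n)`, and the difference of the two sums is the total excess. -/
theorem sum_excess_le_one (hw : w.val 0 < 1) {x : XSpace 𝕜 w} (hx : ‖x‖ ≤ 1) (F : Finset ℕ) :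
    ∑ n ∈ F, excess w n ‖coord 𝕜 w x n‖ ≤ 1 := by
  classical
  set F' := F.filter fun n => w.val n < ‖coord 𝕜 w x n‖
  have hF' : ∀ n ∈ F', w.val n < ‖coord 𝕜 w x n‖ := fun n hn => (Finset.mem_filter.1 hn).2
  have h1w : ∀ n, 0 < 1 - w.val n := fun n => sub_pos.2 (Weight.val_lt_one hw n)
  have hsum : ∑ n ∈ F, excess w n ‖coord 𝕜 w x n‖ =
      ∑ n ∈ F', (‖coord 𝕜 w x n‖ - w.val n) / (1 - w.val n) := by
    rw [Finset.sum_filter]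
    refine Finset.sum_congr rfl fun n _ => ?_
    split_ifs with h
    · exact excess_of_ge h.le
    · exact excess_of_le (not_lt.1 h)
  let c : ℕ → 𝕜 := fun n =>
    (((‖coord 𝕜 w x n‖ * (1 - w.val n))⁻¹ : ℝ) : 𝕜) * (starRingEnd 𝕜) (coord 𝕜 w x n)
  have hcn : ∀ n ∈ F', ‖c n‖ = (1 - w.val n)⁻¹ := fun n hn => by
    have h2 : 0 < ‖coord 𝕜 w x n‖ := (w.pos n).trans (hF' n hn)
    have h3 := h1w n
    simp only [c]
    rw [norm_mul, RCLike.norm_ofReal, RCLike.norm_conj, abs_of_pos (by positivity)]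
    field_simp
  have hcx : ∀ n ∈ F', c n * coord 𝕜 w x n =
      ((‖coord 𝕜 w x n‖ / (1 - w.val n) : ℝ) : 𝕜) := fun n hn => by
    have h2 : 0 < ‖coord 𝕜 w x n‖ := (w.pos n).trans (hF' n hn)
    have h3 := h1w n
    simp only [c]
    rw [mul_assoc, RCLike.conj_mul, ← RCLike.ofReal_pow, ← RCLike.ofReal_mul]
    congr 1
    field_simp
  have hz := ZSpace.norm_sum_single_le (𝕜 := 𝕜) hw F' c zero_le_one fun n hn => by
    rw [hcn n hn, mul_inv_cancel₀ (h1w n).ne']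
  have hxz := (norm_toDual_apply_le x (∑ n ∈ F', c n • ZSpace.single 𝕜 w n)).trans
    (mul_le_of_le_one_left (norm_nonneg _) hx)
  rw [toDual_sum_single, Finset.sum_congr rfl hcx, ← RCLike.ofReal_sum, RCLike.norm_ofReal] at hxz
  have h4 := ((le_abs_self _).trans hxz).trans hz
  rw [Finset.sum_congr (s₁ := F') (f := fun n => w.val n * ‖c n‖) rfl
    fun n hn => by rw [hcn n hn]] at h4
  rw [hsum, Finset.sum_congr rfl fun n _ => sub_div _ _ _, Finset.sum_sub_distrib]
  simp only [div_eq_mul_inv] at h4 ⊢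
  linarith

/-- Since `|x_n| ≤ w_n + (1 - w_n) * excess`, pairing with `z` splits into an `ℓ₁` part weighted by
`w` and a part bounded by the supremum of `(1 - w)|z|` times the total excess. Truncation reduces to
finite sums. -/
theorem norm_le_one_of_sum_excess_le (hw : w.val 0 < 1) {x : XSpace 𝕜 w}
    (hx : ∀ F : Finset ℕ, ∑ n ∈ F, excess w n ‖coord 𝕜 w x n‖ ≤ 1) : ‖x‖ ≤ 1 := by
  refine norm_le_of_toDual zero_le_one fun z => ?_
  have hlim : Tendsto (fun N => ‖toDual 𝕜 w (trunc N x) z‖) atTop (𝓝 ‖toDual 𝕜 w x z‖) := by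
    have hc : Continuous fun y : XSpace 𝕜 w => ‖toDual 𝕜 w y z‖ :=
      ((ContinuousLinearMap.apply 𝕜 𝕜 z).continuous.comp continuous_subtype_val).norm
    exact (hc.tendsto x).comp (tendsto_trunc x)
  refine le_of_tendsto' hlim fun N => ?_
  rw [toDual_trunc, ZSpace.trunc, toDual_sum_single, one_mul, ZSpace.norm_def]
  set s := ⨆ n, |1 - w.val n| * ‖ZSpace.coord 𝕜 w z n‖
  have hs : 0 ≤ s := ZSpace.iSup_nonneg z
  calc ‖∑ n ∈ Finset.range N, ZSpace.coord 𝕜 w z n * coord 𝕜 w x n‖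
      ≤ ∑ n ∈ Finset.range N, (s * excess w n ‖coord 𝕜 w x n‖ +
          w.val n * ‖ZSpace.coord 𝕜 w z n‖) := by
        refine (norm_sum_le _ _).trans (Finset.sum_le_sum fun n _ => ?_)
        rw [norm_mul]
        have h1 := mul_le_mul_of_nonneg_left (le_val_add_mul_excess hw n ‖coord 𝕜 w x n‖)
          (norm_nonneg (ZSpace.coord 𝕜 w z n))
        have h2 := mul_le_mul_of_nonneg_right (ZSpace.one_sub_mul_norm_coord_le z n)
          (excess_nonneg hw n ‖coord 𝕜 w x n‖)
        linarith
    _ = s * ∑ n ∈ Finset.range N, excess w n ‖coord 𝕜 w x n‖ +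
          ∑ n ∈ Finset.range N, w.val n * ‖ZSpace.coord 𝕜 w z n‖ := by
        rw [Finset.sum_add_distrib, Finset.mul_sum]
    _ ≤ s + ∑' n, w.val n * ‖ZSpace.coord 𝕜 w z n‖ :=
        add_le_add (mul_le_of_le_one_right hs (hx _))
          ((ZSpace.summable z).sum_le_tsum _ fun n _ => ZSpace.term_nonneg z n)

/-- A coordinate of a point of the unit ball can be decreased or increased freely within the
weight. -/
theorem norm_add_smul_unit_le (hw : w.val 0 < 1) {x : XSpace 𝕜 w} (hx : ‖x‖ ≤ 1) {m : ℕ} {c : 𝕜}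
    (hc : ‖coord 𝕜 w x m‖ + ‖c‖ ≤ w.val m) : ‖x + c • unit 𝕜 w m‖ ≤ 1 := by
  refine norm_le_one_of_sum_excess_le hw fun F =>
    (Finset.sum_le_sum fun n _ => ?_).trans (sum_excess_le_one hw hx F)
  rw [map_add, map_smul, coord_unit]
  by_cases h : n = m
  · subst h
    rw [excess_of_le]
    · exact excess_nonneg hw _ _
    · simpa using (norm_add_le _ _).trans hc
  · simp [Pi.single_eq_of_ne h]

/-- The weights of the coordinates of a point of `X(w)` that reach the weight are summable. -/
theorem summable_indicator_val_le (hw : w.val 0 < 1) (x : XSpace 𝕜 w) :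
    Summable ({n | w.val n ≤ ‖coord 𝕜 w x n‖}.indicator w.val) := by
  obtain ⟨N, hN⟩ := (Metric.tendsto_atTop.1 (tendsto_trunc x)) (1 / 2) one_half_pos
  have hN := hN N le_rfl
  rw [dist_eq_norm'] at hN
  -- Doubling a tail of norm below `1/2` stays in the ball and turns `|x_n| ≥ w_n` into modulus at
  -- least `2 w_n`, whose excess is at least `w_n / (1 - w_n) ≥ w_n`.
  set y : XSpace 𝕜 w := (2 : 𝕜) • (x - trunc N x)
  have hy : ‖y‖ ≤ 1 := by
    rw [norm_smul, RCLike.norm_ofNat]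
    linarith
  have hsum : Summable fun n => excess w n ‖coord 𝕜 w y n‖ :=
    summable_of_sum_le (fun n => excess_nonneg hw _ _) (sum_excess_le_one hw hy)
  rw [← summable_nat_add_iff N]
  refine Summable.of_nonneg_of_le (fun n => indicator_nonneg (fun m _ => (w.pos m).le) _)
    (fun n => ?_) ((summable_nat_add_iff N).2 hsum)
  by_cases hn : n + N ∈ {n | w.val n ≤ ‖coord 𝕜 w x n‖}
  · rw [indicator_of_mem hn]
    have hco : ‖coord 𝕜 w y (n + N)‖ = 2 * ‖coord 𝕜 w x (n + N)‖ := by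
      simp [y, coord_trunc]
    have hn : w.val (n + N) ≤ ‖coord 𝕜 w x (n + N)‖ := hn
    have h1 := w.pos (n + N)
    have h2 := Weight.val_lt_one hw (n + N)
    rw [hco, excess_of_ge (by linarith), le_div_iff₀ (by linarith)]
    nlinarith
  · rw [indicator_of_notMem hn]
    exact excess_nonneg hw _ _

theorem norm_le_one_of_norm_coord_le (hw : w.val 0 < 1) {x : XSpace 𝕜 w} (m : ℕ)
    (hm : ‖coord 𝕜 w x m‖ ≤ 1) (hx : ∀ n ≠ m, ‖coord 𝕜 w x n‖ ≤ w.val n) : ‖x‖ ≤ 1 := by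
  refine norm_le_one_of_sum_excess_le hw fun F => ?_
  calc ∑ n ∈ F, excess w n ‖coord 𝕜 w x n‖ ≤ ∑ n ∈ F, if n = m then 1 else 0 := by
        refine Finset.sum_le_sum fun n _ => ?_
        split_ifs with h
        · subst h
          have := Weight.val_lt_one hw n
          rw [excess, div_le_one (by linarith), max_le_iff]
          constructor <;> linarith
        · exact (excess_of_le (hx n h)).le
    _ ≤ 1 := by
        rw [Finset.sum_ite_eq']
        split_ifs <;> norm_num

/-- The coordinate `1` at `m` uses up the whole excess allowance, so the coordinate at `n` may have
none: the norm determines `w_n`. The vector is given by its coordinates so that the result also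
applies to its permuted image. -/
theorem norm_unit_add_smul_unit_le_iff (hw : w.val 0 < 1) {m n : ℕ} (hmn : m ≠ n) {s : ℝ}
    (hs : 0 ≤ s) {x : XSpace 𝕜 w}
    (hx : ∀ k, coord 𝕜 w x k = if k = m then 1 else if k = n then (s : 𝕜) else 0) :
    ‖x‖ ≤ 1 ↔ s ≤ w.val n := by
  have hsn : ‖(s : 𝕜)‖ = s := by rw [RCLike.norm_ofReal, abs_of_nonneg hs]
  constructor
  · intro h
    have h1 := sum_excess_le_one hw h {m, n}
    have hm := Weight.val_lt_one hw m
    have hn := Weight.val_lt_one hw n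
    rw [Finset.sum_pair hmn, hx, hx, if_pos rfl, if_neg hmn.symm, if_pos rfl, hsn, norm_one,
      excess_of_ge hm.le, div_self (by linarith)] at h1
    by_contra! hlt
    rw [excess_of_ge hlt.le] at h1
    have : 0 < (s - w.val n) / (1 - w.val n) := div_pos (by linarith) (by linarith)
    linarith
  · intro h
    refine norm_le_one_of_norm_coord_le hw m (by simp [hx]) fun k hk => ?_
    rw [hx, if_neg hk]
    split_ifs with hkn
    · subst hkn
      rwa [hsn]
    · simpa using (w.pos k).le

/-- A permutation that acts isometrically on `X(w)` preserves the weight. -/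
theorem val_perm (hw : w.val 0 < 1) {G : Subgroup (Equiv.Perm ℕ)}
    (hG : IsCompatibleAction (coord 𝕜 w) G) {g : Equiv.Perm ℕ} (hg : g ∈ G) (n : ℕ) :
    w.val (g n) = w.val n := by
  have key : ∀ g ∈ G, ∀ n, w.val n ≤ w.val (g n) := by
    intro g hg n
    obtain ⟨m, hm⟩ := exists_ne n
    have hx : ∀ k, coord 𝕜 w (unit 𝕜 w m + ((w.val n : ℝ) : 𝕜) • unit 𝕜 w n) k =
        if k = m then 1 else if k = n then ((w.val n : ℝ) : 𝕜) else 0 := fun k => by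
      rw [map_add, map_smul, coord_unit, coord_unit]
      by_cases h1 : k = m
      · subst h1
        simp [hm]
      · simp only [Pi.add_apply, Pi.smul_apply, Pi.single_apply, if_neg h1, zero_add, smul_eq_mul,
          mul_ite, mul_one, mul_zero]
    obtain ⟨y, hy, hyn⟩ := hG g hg (unit 𝕜 w m + ((w.val n : ℝ) : 𝕜) • unit 𝕜 w n)
    rw [← norm_unit_add_smul_unit_le_iff hw (g.injective.ne hm) (w.pos n).le (x := y), hyn,
      norm_unit_add_smul_unit_le_iff hw hm (w.pos n).le hx]
    intro k
    obtain ⟨k, rfl⟩ := g.surjective k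
    rw [hy, hx]
    simp
  refine le_antisymm ?_ (key g hg n)
  simpa using key g⁻¹ (G.inv_mem hg) (g n)

end XSpace

/-! ## Operators on `X(w)` -/

namespace XSpace

variable {𝕜 : Type*} [RCLike 𝕜] {w : Weight} {A : Set ℕ}

variable (𝕜) in
/-- The sequences bounded by `1`. -/
def unitCube : Set (ℕ → 𝕜) := {b | ∀ n, ‖b n‖ ≤ 1}

theorem isCompact_unitCube : IsCompact (unitCube 𝕜) := by
  have h : unitCube 𝕜 = Set.pi univ fun _ => Metric.closedBall 0 1 := by
    ext b
    simp [unitCube]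
  rw [h]
  exact isCompact_univ_pi fun _ => isCompact_closedBall _ _

theorem zero_mem_unitCube : (0 : ℕ → 𝕜) ∈ unitCube 𝕜 := fun n => by simp

theorem smul_mem_unitCube {b : ℕ → 𝕜} (hb : b ∈ unitCube 𝕜) {c : 𝕜} (hc : ‖c‖ ≤ 1) :
    c • b ∈ unitCube 𝕜 := fun n => by
  rw [Pi.smul_apply, norm_smul]
  exact mul_le_one₀ hc (norm_nonneg _) (hb n)

variable (w A) in
/-- The sequence `w b`, restricted to a set `A` on which the weight is summable, as an element
of `X(w)`. -/
noncomputable def weighted (b : ℕ → 𝕜) : XSpace 𝕜 w :=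
  ∑' n, ((A.indicator w.val n : ℝ) : 𝕜) • b n • unit 𝕜 w n

theorem indicator_val_nonneg (n : ℕ) : 0 ≤ A.indicator w.val n :=
  indicator_nonneg (fun m _ => (w.pos m).le) n

theorem norm_weighted_term_le {b : ℕ → 𝕜} (hb : b ∈ unitCube 𝕜) (n : ℕ) :
    ‖((A.indicator w.val n : ℝ) : 𝕜) • b n • unit 𝕜 w n‖ ≤ A.indicator w.val n := by
  rw [norm_smul, norm_smul, RCLike.norm_ofReal, abs_of_nonneg (indicator_val_nonneg n)]
  exact mul_le_of_le_one_right (indicator_val_nonneg n)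
    (mul_le_one₀ (hb n) (norm_nonneg _) (norm_unit_le n))

theorem summable_weighted (hA : Summable (A.indicator w.val)) {b : ℕ → 𝕜} (hb : b ∈ unitCube 𝕜) :
    Summable fun n => ((A.indicator w.val n : ℝ) : 𝕜) • b n • unit 𝕜 w n :=
  Summable.of_norm_bounded hA (norm_weighted_term_le hb)

/-- The Weierstrass test with majorant `w` on `A`. This is where summability on `A` enters: for
fixed `m` the vertices form a compact set. -/
theorem continuousOn_weighted (hA : Summable (A.indicator w.val)) :
    ContinuousOn (weighted (𝕜 := 𝕜) w A) (unitCube 𝕜) :=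
  continuousOn_tsum (fun n => by fun_prop) hA fun n _ hb => norm_weighted_term_le hb n

theorem weighted_smul (c : 𝕜) (b : ℕ → 𝕜) : weighted w A (c • b) = c • weighted w A b := by
  rw [weighted, weighted, ← tsum_const_smul'']
  refine tsum_congr fun n => ?_
  simp only [Pi.smul_apply, smul_smul, smul_eq_mul]
  congr 1
  ring

theorem coord_weighted (hA : Summable (A.indicator w.val)) {b : ℕ → 𝕜} (hb : b ∈ unitCube 𝕜)
    (n : ℕ) : coord 𝕜 w (weighted w A b) n = ((A.indicator w.val n : ℝ) : 𝕜) * b n := by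
  rw [← coordFunctional_apply, weighted, (coordFunctional 𝕜 w n).map_tsum (summable_weighted hA hb),
    tsum_eq_single n]
  · simp [coordFunctional_apply, coord_unit]
  · intro m hm
    simp [coordFunctional_apply, coord_unit, Pi.single_eq_of_ne' hm]

variable (w A) in
/-- The points whose convex combinations approximate the points of the unit ball that are supported
by `A`. -/
noncomputable def vertex (m : ℕ) (b : ℕ → 𝕜) : XSpace 𝕜 w :=
  ((1 - w.val m : ℝ) : 𝕜) • unit 𝕜 w m + weighted w A b

theorem coord_vertex (hA : Summable (A.indicator w.val)) {b : ℕ → 𝕜} (hb : b ∈ unitCube 𝕜)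
    (m n : ℕ) : coord 𝕜 w (vertex w A m b) n =
      (if n = m then ((1 - w.val m : ℝ) : 𝕜) else 0) + ((A.indicator w.val n : ℝ) : 𝕜) * b n := by
  rw [vertex, map_add, map_smul, Pi.add_apply, coord_weighted hA hb, coord_unit, Pi.smul_apply,
    Pi.single_apply, smul_eq_mul, mul_ite, mul_one, mul_zero]

theorem norm_indicator_mul_le {b : ℕ → 𝕜} (hb : b ∈ unitCube 𝕜) (n : ℕ) :
    ‖((A.indicator w.val n : ℝ) : 𝕜) * b n‖ ≤ w.val n := by
  rw [norm_mul, RCLike.norm_ofReal, abs_of_nonneg (indicator_val_nonneg n)]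
  exact (mul_le_of_le_one_right (indicator_val_nonneg n) (hb n)).trans
    (indicator_le_self' (fun m _ => (w.pos m).le) n)

theorem norm_vertex_le (hw : w.val 0 < 1) (hA : Summable (A.indicator w.val)) {b : ℕ → 𝕜}
    (hb : b ∈ unitCube 𝕜) (m : ℕ) : ‖vertex w A m b‖ ≤ 1 := by
  refine norm_le_one_of_norm_coord_le hw m ?_ fun n hn => ?_
  · rw [coord_vertex hA hb, if_pos rfl]
    refine (norm_add_le _ _).trans ?_
    have := norm_indicator_mul_le (w := w) (A := A) hb m
    rw [RCLike.norm_ofReal, abs_of_pos (sub_pos.2 (Weight.val_lt_one hw m))]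
    linarith
  · rw [coord_vertex hA hb, if_neg hn, zero_add]
    exact norm_indicator_mul_le hb n

/-- The Minkowski decomposition of the ball, one coordinate at a time: a part within the weight,
plus a phase carrying the excess. -/
theorem exists_excess_decomposition (hw : w.val 0 < 1) (n : ℕ) (t : 𝕜) :
    ∃ θ b : 𝕜, ‖θ‖ = 1 ∧ ‖b‖ ≤ 1 ∧
      t = ((1 - w.val n : ℝ) : 𝕜) * (((excess w n ‖t‖ : ℝ) : 𝕜) * θ) + (w.val n : 𝕜) * b := by
  have hpos := w.pos n
  rcases le_or_gt ‖t‖ (w.val n) with h | h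
  · refine ⟨1, t / (w.val n : 𝕜), norm_one, ?_, ?_⟩
    · rw [norm_div, RCLike.norm_ofReal, abs_of_pos hpos]
      exact div_le_one_of_le₀ h hpos.le
    · have : (w.val n : 𝕜) ≠ 0 := by exact_mod_cast hpos.ne'
      rw [excess_of_le h]
      field_simp
      simp
  · have ht : ‖t‖ ≠ 0 := (hpos.trans h).ne'
    have ht' : ((‖t‖ : ℝ) : 𝕜) ≠ 0 := by exact_mod_cast ht
    have hnorm : ‖t / ((‖t‖ : ℝ) : 𝕜)‖ = 1 := by
      rw [norm_div, RCLike.norm_ofReal, abs_norm, div_self ht]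
    refine ⟨t / ((‖t‖ : ℝ) : 𝕜), t / ((‖t‖ : ℝ) : 𝕜), hnorm, hnorm.le, ?_⟩
    rw [← mul_assoc, ← RCLike.ofReal_mul, excess_of_ge h.le,
      mul_div_cancel₀ _ (sub_pos.2 (Weight.val_lt_one hw n)).ne', ← add_mul, ← RCLike.ofReal_add,
      sub_add_cancel, mul_div_cancel₀ _ ht']

variable {Y : Type*} [NormedAddCommGroup Y] [NormedSpace 𝕜 Y]

/-- The vector `weighted w A b` is half the difference of the vertices for `b` and `-b`. -/
theorem norm_apply_weighted_le {T : XSpace 𝕜 w →L[𝕜] Y} {B : ℝ} {m : ℕ}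
    (hB : ∀ b ∈ unitCube 𝕜, ‖T (vertex w A m b)‖ ≤ B) {b : ℕ → 𝕜} (hb : b ∈ unitCube 𝕜) :
    ‖T (weighted w A b)‖ ≤ B := by
  have h1 := hB b hb
  have h2 := hB ((-1 : 𝕜) • b) (smul_mem_unitCube hb (by simp))
  have h3 : (2 : 𝕜) • T (weighted w A b) =
      T (vertex w A m b) - T (vertex w A m ((-1 : 𝕜) • b)) := by
    rw [← map_smul, ← map_sub, vertex, vertex, weighted_smul]
    congr 1
    module
  have h4 := norm_sub_le (T (vertex w A m b)) (T (vertex w A m ((-1 : 𝕜) • b)))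
  rw [← h3, norm_smul, RCLike.norm_ofNat] at h4
  linarith

/-- Vertices carry no phase on `e_m`, but the cube is invariant under unimodular scalars, so a phase
can be factored out of the whole vector. -/
theorem norm_apply_rotated_le {T : XSpace 𝕜 w →L[𝕜] Y} {B : ℝ} {m : ℕ}
    (hB : ∀ b ∈ unitCube 𝕜, ‖T (vertex w A m b)‖ ≤ B) {b : ℕ → 𝕜} (hb : b ∈ unitCube 𝕜) {θ : 𝕜}
    (hθ : ‖θ‖ = 1) :
    ‖((1 - w.val m : ℝ) : 𝕜) • θ • T (unit 𝕜 w m) + T (weighted w A b)‖ ≤ B := by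
  have hθ0 : θ ≠ 0 := fun h => by simp [h] at hθ
  have h := hB (θ⁻¹ • b) (smul_mem_unitCube hb (by rw [norm_inv, hθ, inv_one]))
  have h2 : ((1 - w.val m : ℝ) : 𝕜) • θ • T (unit 𝕜 w m) + T (weighted w A b) =
      θ • T (vertex w A m (θ⁻¹ • b)) := by
    rw [vertex, weighted_smul, map_add, map_smul, map_smul, smul_add, smul_smul θ θ⁻¹,
      mul_inv_cancel₀ hθ0, one_smul, smul_comm]
  rwa [h2, norm_smul, hθ, one_mul]

/-- The norm of an operator that vanishes off `A` is determined by its values at the vertices. -/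
theorem opNorm_le_of_vertex_le (hw : w.val 0 < 1) (hA : Summable (A.indicator w.val))
    (hne : A.Nonempty) {T : XSpace 𝕜 w →L[𝕜] Y} (hT : ∀ n ∉ A, T (unit 𝕜 w n) = 0) {B : ℝ}
    (hB : ∀ m ∈ A, ∀ b ∈ unitCube 𝕜, ‖T (vertex w A m b)‖ ≤ B) : ‖T‖ ≤ B := by
  obtain ⟨m₀, hm₀⟩ := hne
  have hB0 : 0 ≤ B := (norm_nonneg _).trans (hB m₀ hm₀ 0 zero_mem_unitCube)
  refine ContinuousLinearMap.opNorm_le_of_unit_norm hB0 fun x hx => ?_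
  refine le_of_tendsto' ((T.continuous.tendsto x).comp (tendsto_trunc x)).norm fun N => ?_
  choose θ b hθ hb hdec using fun n => exists_excess_decomposition hw n (coord 𝕜 w x n)
  set r : ℕ → ℝ := fun n => excess w n ‖coord 𝕜 w x n‖ with hr
  have hr0 : ∀ n, 0 ≤ r n := fun n => excess_nonneg hw n _
  -- Cut at `N` so that `L` is the image of the within-weight part of the truncated vector;
  -- replacing `w` by its restriction to `A` costs nothing, as `T` vanishes off `A`.
  let b' : ℕ → 𝕜 := fun n => if n < N then b n else 0
  have hb' : b' ∈ unitCube 𝕜 := fun n => by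
    simp only [b']
    split_ifs
    · exact hb n
    · simp
  set L := T (weighted w A b') with hL
  have hLsum : L = ∑ n ∈ Finset.range N, (w.val n : 𝕜) • b n • T (unit 𝕜 w n) := by
    rw [hL, weighted, T.map_tsum (summable_weighted hA hb'), tsum_eq_sum (s := Finset.range N)]
    · refine Finset.sum_congr rfl fun n hn => ?_
      rw [map_smul, map_smul]
      simp only [b', if_pos (Finset.mem_range.1 hn)]
      by_cases hnA : n ∈ A
      · rw [indicator_of_mem hnA]
      · simp [hT n hnA]
    · intro n hn
      simp only [b', if_neg (fun h => hn (Finset.mem_range.2 h))]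
      simp
  -- A convex combination: the excesses are the coefficients of the rotated vertices, and the
  -- missing mass goes to `L`, which obeys the same bound.
  have hsplit : T (trunc N x) = ∑ n ∈ Finset.range N,
      (r n : 𝕜) • (((1 - w.val n : ℝ) : 𝕜) • θ n • T (unit 𝕜 w n) + L) +
        ((1 - ∑ n ∈ Finset.range N, r n : ℝ) : 𝕜) • L := by
    simp only [smul_add, Finset.sum_add_distrib, ← Finset.sum_smul]
    rw [add_assoc, ← add_smul, RCLike.ofReal_sub, RCLike.ofReal_sum, RCLike.ofReal_one,
      add_sub_cancel, one_smul, hLsum, ← Finset.sum_add_distrib, trunc_apply, map_sum]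
    refine Finset.sum_congr rfl fun n _ => ?_
    rw [map_smul]
    nth_rewrite 1 [hdec n]
    simp only [smul_smul, ← add_smul]
    congr 1
    ring
  have hsum : ∑ n ∈ Finset.range N, r n ≤ 1 := sum_excess_le_one hw hx.le _
  have hLB : ‖L‖ ≤ B := norm_apply_weighted_le (hB m₀ hm₀) hb'
  have hterm : ∀ n, ‖((1 - w.val n : ℝ) : 𝕜) • θ n • T (unit 𝕜 w n) + L‖ ≤ B := fun n => by
    by_cases hn : n ∈ A
    · exact norm_apply_rotated_le (hB n hn) hb' (hθ n)
    · rw [hT n hn, smul_zero, smul_zero, zero_add]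
      exact hLB
  simp only [Function.comp, hsplit]
  calc _ ≤ ∑ n ∈ Finset.range N, r n * B + (1 - ∑ n ∈ Finset.range N, r n) * B := by
        refine (norm_add_le _ _).trans (add_le_add ((norm_sum_le _ _).trans
          (Finset.sum_le_sum fun n _ => ?_)) ?_)
        · rw [norm_smul, RCLike.norm_ofReal, abs_of_nonneg (hr0 n)]
          exact mul_le_mul_of_nonneg_left (hterm n) (hr0 n)
        · rw [norm_smul, RCLike.norm_ofReal, abs_of_nonneg (by linarith)]
          exact mul_le_mul_of_nonneg_left hLB (by linarith)
    _ = B := by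
        rw [← Finset.sum_mul]
        ring

theorem exists_max_vertex (hA : Summable (A.indicator w.val)) (T : XSpace 𝕜 w →L[𝕜] Y) (m : ℕ) :
    ∃ b ∈ unitCube 𝕜, ∀ b' ∈ unitCube 𝕜, ‖T (vertex w A m b')‖ ≤ ‖T (vertex w A m b)‖ :=
  isCompact_unitCube.exists_isMaxOn ⟨0, zero_mem_unitCube⟩
    ((T.continuous.comp_continuousOn
      (continuousOn_const.add (continuousOn_weighted hA))).norm)

theorem isNormAttaining_of_vertex (hw : w.val 0 < 1) (hA : Summable (A.indicator w.val))
    {T : XSpace 𝕜 w →L[𝕜] Y} {m : ℕ} {b : ℕ → 𝕜} (hb : b ∈ unitCube 𝕜)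
    (h : ‖T‖ ≤ ‖T (vertex w A m b)‖) : IsNormAttaining T :=
  isNormAttaining_of_le (unit_ne_zero 0) (norm_vertex_le hw hA hb m) h

/-! ### Supports of operators on `X(w)` -/

/-- The set of the coordinates that matter for the values of `T`. -/
def support (T : XSpace 𝕜 w →L[𝕜] Y) : Set ℕ := {n | T (unit 𝕜 w n) ≠ 0}

/-- The weights of the coordinates that matter for a norm-attaining operator into a strictly convex
space are summable. -/
theorem summable_indicator_support_of_isNormAttaining (hw : w.val 0 < 1) (hY : HasExtremeSpheres Y)
    {T : XSpace 𝕜 w →L[𝕜] Y} (hT : IsNormAttaining T) :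
    Summable ((support T).indicator w.val) := by
  obtain ⟨x, hx, hTx⟩ := hT
  have hsub : support T ⊆ {n | w.val n ≤ ‖coord 𝕜 w x n‖} := by
    intro n hn
    by_contra hlt
    have hlt : ‖coord 𝕜 w x n‖ < w.val n := not_le.1 hlt
    set δ := w.val n - ‖coord 𝕜 w x n‖
    have hδ : 0 < δ := sub_pos.2 hlt
    have hδ' : ‖(δ : 𝕜)‖ = δ := by rw [RCLike.norm_ofReal, abs_of_pos hδ]
    refine hn (T.apply_eq_zero_of_smul (c := (δ : 𝕜)) (by exact_mod_cast hδ.ne')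
      (hY.apply_eq_zero hTx (norm_add_smul_unit_le hw hx.le ?_) ?_))
    · rw [hδ']
      simp [δ]
    · rw [sub_eq_add_neg, ← neg_smul]
      exact norm_add_smul_unit_le hw hx.le (by rw [norm_neg, hδ']; simp [δ])
  exact Summable.of_nonneg_of_le indicator_val_nonneg
    (fun n => indicator_le_indicator_of_subset hsub (fun m => (w.pos m).le) n)
    (summable_indicator_val_le hw x)

theorem eq_zero_of_support_eq_empty {T : XSpace 𝕜 w →L[𝕜] Y} (hT : support T = ∅) : T = 0 := by
  ext x
  refine tendsto_nhds_unique ((T.continuous.tendsto x).comp (tendsto_trunc x))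
    (tendsto_const_nhds.congr fun N => ?_)
  have h : ∀ n, T (unit 𝕜 w n) = 0 := fun n => by
    by_contra hn
    exact (hT ▸ (show n ∈ support T from hn) : n ∈ (∅ : Set ℕ))
  simp [trunc_apply, h]

/-- The functional `x ↦ ∑ n ∈ O, x n` is evaluation at the indicator of `O` in `Z`, whose norm is at
most `1 + ∑ n ∈ O, w n`. -/
theorem norm_sumSMul_le (hw : w.val 0 < 1) (O : Finset ℕ) (v : Y) :
    ‖sumSMul (continuous_coord (𝕜 := 𝕜) (w := w)) O v‖ ≤ (1 + ∑ n ∈ O, w.val n) * ‖v‖ := by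
  have h0 : 0 ≤ ∑ n ∈ O, w.val n := Finset.sum_nonneg fun n _ => (w.pos n).le
  refine ContinuousLinearMap.opNorm_le_bound _ (by positivity) fun x => ?_
  have h1 := ZSpace.norm_sum_single_le (𝕜 := 𝕜) hw O (fun _ => 1) zero_le_one fun n _ => by
    rw [norm_one, mul_one]
    linarith [w.pos n]
  have h2 := norm_toDual_apply_le x (∑ n ∈ O, (1 : 𝕜) • ZSpace.single 𝕜 w n)
  rw [toDual_sum_single] at h2
  simp only [norm_one, mul_one, one_mul] at h1 h2
  rw [sumSMul_apply, norm_smul]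
  calc _ ≤ (‖x‖ * (1 + ∑ n ∈ O, w.val n)) * ‖v‖ :=
        mul_le_mul_of_nonneg_right (h2.trans (mul_le_mul_of_nonneg_left h1 (norm_nonneg _)))
          (norm_nonneg _)
    _ = _ := by ring

/-- If no vertex over `A` attains the norm of `T`, then vertices far out nearly attain it. -/
theorem exists_vertex_far (hw : w.val 0 < 1) (hA : Summable (A.indicator w.val))
    (hne : A.Nonempty) {T : XSpace 𝕜 w →L[𝕜] Y} (hT : ∀ n ∉ A, T (unit 𝕜 w n) = 0)
    (hlt : ∀ m ∈ A, ∀ b ∈ unitCube 𝕜, ‖T (vertex w A m b)‖ < ‖T‖) {E : Set ℕ} (hE : E.Finite)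
    {r : ℝ} (hr : r < ‖T‖) :
    ∃ m ∈ A, m ∉ E ∧ ∃ b ∈ unitCube 𝕜, r < ‖T (vertex w A m b)‖ := by
  by_contra! hcon
  choose b hb hmax using exists_max_vertex (𝕜 := 𝕜) hA T
  -- Over the finite set `E` the compact maxima stay strictly below `‖T‖`, so some `B < ‖T‖` bounds
  -- them and is also at least `r`; it would then bound `T` at all vertices.
  have h1 : ∀ᶠ B in 𝓝[<] ‖T‖, ∀ m ∈ E, m ∈ A → ‖T (vertex w A m (b m))‖ ≤ B := by
    rw [Filter.eventually_all_finite hE]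
    intro m _
    by_cases hm : m ∈ A
    · filter_upwards [nhdsWithin_le_nhds (eventually_ge_nhds (hlt m hm (b m) (hb m)))] with B hB _
      exact hB
    · simp [hm]
  obtain ⟨B, ⟨hB1, hB2⟩, hB3⟩ := ((h1.and (nhdsWithin_le_nhds (eventually_ge_nhds hr))).and
    self_mem_nhdsWithin).exists
  refine absurd (opNorm_le_of_vertex_le hw hA hne hT (B := B) fun m hm b' hb' => ?_)
    (not_le.2 hB3)
  by_cases hmE : m ∈ E
  · exact (hmax m b' hb').trans (hB1 m hmE hm)
  · exact (hcon m hm hmE b' hb').trans hB2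

end XSpace

/-! ### Perturbation to norm-attaining operators -/

namespace XSpace

variable {𝕜 : Type*} [RCLike 𝕜] {w : Weight} {A : Set ℕ}
  {Y : Type*} [NormedAddCommGroup Y] [NormedSpace 𝕜 Y]

theorem sum_coord_vertex (hA : Summable (A.indicator w.val)) {O : Finset ℕ} (hO : ↑O ⊆ A)
    {b : ℕ → 𝕜} (hb : b ∈ unitCube 𝕜) (m : ℕ) :
    ∑ n ∈ O, coord 𝕜 w (vertex w A m b) n =
      (if m ∈ O then ((1 - w.val m : ℝ) : 𝕜) else 0) + ∑ n ∈ O, (w.val n : 𝕜) * b n := by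
  rw [Finset.sum_congr rfl fun n hn => by
    rw [coord_vertex hA hb, indicator_of_mem (hO hn)], Finset.sum_add_distrib,
    Finset.sum_ite_eq']

theorem norm_sum_val_mul_le {b : ℕ → 𝕜} (hb : b ∈ unitCube 𝕜) (O : Finset ℕ) :
    ‖∑ n ∈ O, (w.val n : 𝕜) * b n‖ ≤ ∑ n ∈ O, w.val n := by
  refine (norm_sum_le _ _).trans (Finset.sum_le_sum fun n _ => ?_)
  rw [norm_mul, RCLike.norm_ofReal, abs_of_pos (w.pos n)]
  exact mul_le_of_le_one_right (w.pos n).le (hb n)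

/-- If some vertex with index in a light set `O`, on which `T` and the weight are constant, nearly
attains the norm of `T`, then a small perturbation of `T` on `O` attains its norm. -/
theorem exists_isNormAttaining_add_sumSMul (hw : w.val 0 < 1) (hA : Summable (A.indicator w.val))
    {T : XSpace 𝕜 w →L[𝕜] Y} (hT : ∀ n ∉ A, T (unit 𝕜 w n) = 0) {O : Finset ℕ} (hO : ↑O ⊆ A)
    {m : ℕ} (hm : m ∈ O) (hTO : ∀ n ∈ O, T (unit 𝕜 w n) = T (unit 𝕜 w m))
    (hwO : ∀ n ∈ O, w.val n = w.val m) (hσ : ∑ n ∈ O, w.val n ≤ 1 / 12)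
    {η : ℝ} (hη : 0 < η) {b : ℕ → 𝕜} (hb : b ∈ unitCube 𝕜)
    (hpos : 0 < ‖T (vertex w A m b)‖) (hnear : ‖T‖ - η / 2 < ‖T (vertex w A m b)‖) :
    ∃ v : Y, ‖v‖ = η ∧ IsNormAttaining (T + sumSMul (continuous_coord (𝕜 := 𝕜)) O v) := by
  set σ := ∑ n ∈ O, w.val n with hσdef
  set y := T (vertex w A m b) with hy
  -- Pointing along `y`, the perturbation adds the full `(1 - w_m) η` to the norm at this vertex, up
  -- to an error `σ η` from the cube part.
  let v : Y := ((η / ‖y‖ : ℝ) : 𝕜) • y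
  have hv : ‖v‖ = η := by
    simp only [v]
    rw [norm_smul, RCLike.norm_ofReal, abs_of_pos (by positivity), div_mul_cancel₀ _ hpos.ne']
  refine ⟨v, hv, ?_⟩
  set T' := T + sumSMul (continuous_coord (𝕜 := 𝕜)) O v with hT'
  have hT'v : ∀ k, ∀ b' ∈ unitCube 𝕜, T' (vertex w A k b') = T (vertex w A k b') +
      ((if k ∈ O then ((1 - w.val k : ℝ) : 𝕜) else 0) + ∑ n ∈ O, (w.val n : 𝕜) * b' n) • v :=
    fun k b' hb' => by
      rw [hT', add_apply, sumSMul_apply, sum_coord_vertex hA hO hb']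
  have hwm : w.val m ≤ σ := Finset.single_le_sum (fun n _ => (w.pos n).le) hm
  -- The lower bound obtained is `‖T‖ - η/2 + (1 - σ)η - ση`, which suffices as soon as `3σ ≤ 1/2`;
  -- the right side is the most that vertices outside `O` can reach.
  have hlow : ‖T‖ + η * σ ≤ ‖T' (vertex w A m b)‖ := by
    rw [hT'v m b hb, if_pos hm, add_smul, ← add_assoc]
    have h1 : y + ((1 - w.val m : ℝ) : 𝕜) • v =
        ((1 + (1 - w.val m) * (η / ‖y‖) : ℝ) : 𝕜) • y := by
      simp only [v]
      rw [smul_smul, RCLike.ofReal_add, RCLike.ofReal_one, add_smul, one_smul, RCLike.ofReal_mul]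
    have h1w : 0 < 1 - w.val m := sub_pos.2 (Weight.val_lt_one hw m)
    have h2 : ‖y + ((1 - w.val m : ℝ) : 𝕜) • v‖ = ‖y‖ + (1 - w.val m) * η := by
      rw [h1, norm_smul, RCLike.norm_ofReal, abs_of_pos (by positivity)]
      field_simp
    have h3 : ‖(∑ n ∈ O, (w.val n : 𝕜) * b n) • v‖ ≤ σ * η := by
      rw [norm_smul, hv]
      exact mul_le_mul_of_nonneg_right (norm_sum_val_mul_le hb O) hη.le
    have h4 := norm_sub_le (y + ((1 - w.val m : ℝ) : 𝕜) • v + (∑ n ∈ O, (w.val n : 𝕜) * b n) • v)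
      ((∑ n ∈ O, (w.val n : 𝕜) * b n) • v)
    rw [add_sub_cancel_right, h2] at h4
    nlinarith
  obtain ⟨b₁, hb₁, hmax⟩ := exists_max_vertex hA T' m
  refine isNormAttaining_of_vertex hw hA hb₁ (m := m)
    (opNorm_le_of_vertex_le hw hA ⟨m, hO hm⟩ (fun n hn => ?_) fun k _ b' hb' => ?_)
  · rw [hT', add_apply, hT n hn, sumSMul_unit _ coord_unit, if_neg (fun h : n ∈ O => hn (hO h)),
      add_zero]
  · by_cases hkO : k ∈ O
    -- All indices in `O` give the same vertex values, so the one compact maximum at `m` covers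
    -- them.
    · have h1 : T' (unit 𝕜 w k) = T' (unit 𝕜 w m) := by
        rw [hT', add_apply, add_apply, hTO k hkO, sumSMul_unit _ coord_unit,
          sumSMul_unit _ coord_unit, if_pos hkO, if_pos hm]
      have h2 : T' (vertex w A k b') = T' (vertex w A m b') := by
        rw [vertex, vertex, map_add, map_add, map_smul, map_smul, h1, hwO k hkO]
      rw [h2]
      exact hmax b' hb'
    · refine le_trans ?_ (hlow.trans (hmax b hb))
      rw [hT'v k b' hb', if_neg hkO, zero_add]
      refine (norm_add_le _ _).trans (add_le_add
        (T.unit_le_opNorm _ (norm_vertex_le hw hA hb' k)) ?_)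
      rw [norm_smul, hv, mul_comm]
      exact mul_le_mul_of_nonneg_left (norm_sum_val_mul_le hb' O) hη.le

/-! ### Orbits and density of norm-attaining invariant operators -/

section Invariant

variable {G : Subgroup (Equiv.Perm ℕ)}

theorem val_eq_of_mem_orbit (hw : w.val 0 < 1) (hG : IsCompatibleAction (coord 𝕜 w) G) {m n : ℕ}
    (hn : n ∈ MulAction.orbit G m) : w.val n = w.val m := by
  obtain ⟨⟨g, hg⟩, rfl⟩ := hn
  exact val_perm hw hG hg m

theorem apply_unit_eq_of_mem_orbit {T : XSpace 𝕜 w →L[𝕜] Y}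
    (hT : T ∈ invariantOperators Y (coord 𝕜 w) G) {m n : ℕ} (hn : n ∈ MulAction.orbit G m) :
    T (unit 𝕜 w n) = T (unit 𝕜 w m) := by
  obtain ⟨⟨g, hg⟩, rfl⟩ := hn
  exact apply_unit_perm coord_unit hT hg m

theorem orbit_subset_support {T : XSpace 𝕜 w →L[𝕜] Y}
    (hT : T ∈ invariantOperators Y (coord 𝕜 w) G) {m : ℕ} (hm : m ∈ support T) :
    MulAction.orbit G m ⊆ support T := fun n hn => by
  change T (unit 𝕜 w n) ≠ 0
  rwa [apply_unit_eq_of_mem_orbit hT hn]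

/-- The weight is constant and positive on an orbit, while summable terms tend to `0`. -/
theorem finite_orbit (hw : w.val 0 < 1) (hG : IsCompatibleAction (coord 𝕜 w) G)
    (hA : Summable (A.indicator w.val)) {m : ℕ} (hm : MulAction.orbit G m ⊆ A) :
    (MulAction.orbit G m).Finite := by
  have h := hA.tendsto_cofinite_zero.eventually (gt_mem_nhds (w.pos m))
  refine Set.Finite.subset (Filter.eventually_cofinite.1 h) fun n hn => ?_
  change ¬A.indicator w.val n < w.val m
  rw [indicator_of_mem (hm hn), val_eq_of_mem_orbit hw hG hn]
  exact lt_irrefl _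

/-- An invariant operator for which the weights of the relevant coordinates are summable is a limit
of norm-attaining invariant operators. -/
theorem mem_closure_isNormAttaining (hw : w.val 0 < 1) (hG : IsCompatibleAction (coord 𝕜 w) G)
    (T : invariantOperators Y (coord 𝕜 w) G)
    (hA : Summable ((support (T : XSpace 𝕜 w →L[𝕜] Y)).indicator w.val)) :
    T ∈ closure {T : invariantOperators Y (coord 𝕜 w) G |
      IsNormAttaining (T : XSpace 𝕜 w →L[𝕜] Y)} := by
  obtain ⟨T, hTG⟩ := T
  change Summable ((support T).indicator w.val) at hA
  set A := support T with hAdef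
  have hT : ∀ n ∉ A, T (unit 𝕜 w n) = 0 := fun n hn => not_not.1 hn
  by_cases hNA : IsNormAttaining T
  · exact subset_closure hNA
  have hlt : ∀ m ∈ A, ∀ b ∈ unitCube 𝕜, ‖T (vertex w A m b)‖ < ‖T‖ := by
    intro m _ b hb
    by_contra! hle
    exact hNA (isNormAttaining_of_vertex hw hA hb hle)
  have hT0 : T ≠ 0 := by
    rintro rfl
    exact hNA (isNormAttaining_of_le (unit_ne_zero 0) (x := 0) (by simp) (by simp))
  have hne : A.Nonempty := by
    rw [nonempty_iff_ne_empty]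
    exact fun h => hT0 (eq_zero_of_support_eq_empty h)
  rw [Metric.mem_closure_iff]
  intro ε hε
  obtain ⟨s, hs⟩ := summable_iff_vanishing_norm.1 hA (1 / 12) (by norm_num)
  have horb : ∀ m ∈ A, (MulAction.orbit G m).Finite := fun m hm =>
    finite_orbit hw hG hA (orbit_subset_support hTG hm)
  -- Excluding whole orbits that meet `s` inside `A`, and not just `s`, makes the entire orbit of
  -- the chosen `m` disjoint from `s`, hence of weight below `1/12`.
  have hE : (⋃ j ∈ (s : Set ℕ) ∩ A, MulAction.orbit G j).Finite :=
    (s.finite_toSet.inter_of_left A).biUnion fun j hj => horb j hj.2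
  have hTpos : 0 < ‖T‖ := norm_pos_iff.2 hT0
  obtain ⟨m, hmA, hmE, b, hb, hr⟩ := exists_vertex_far hw hA hne hT hlt hE
    -- The maximum with `0` ensures that the vertex value is nonzero, so it defines a direction.
    -- With `η = ε / 4` the perturbation has norm at most `(1 + 1/12) ε / 4 < ε`.
    (r := max (‖T‖ - ε / 4 / 2) 0) (max_lt (by linarith) hTpos)
  set O := (horb m hmA).toFinset
  have hOmem : ∀ n, n ∈ O ↔ n ∈ MulAction.orbit G m := fun n => (horb m hmA).mem_toFinset
  have hOA : ↑O ⊆ A := fun n hn => orbit_subset_support hTG hmA ((hOmem n).1 hn)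
  have hσ : ∑ n ∈ O, w.val n ≤ 1 / 12 := by
    have hdisj : Disjoint O s := by
      rw [Finset.disjoint_left]
      intro n hn hns
      refine hmE (mem_biUnion ⟨hns, hOA hn⟩ ?_)
      rw [MulAction.orbit_eq_iff.2 ((hOmem n).1 hn)]
      exact MulAction.mem_orbit_self m
    have h := (le_abs_self _).trans (hs O hdisj).le
    rwa [Finset.sum_congr rfl fun n hn => indicator_of_mem (hOA hn) w.val] at h
  obtain ⟨v, hv, hatt⟩ := exists_isNormAttaining_add_sumSMul hw hA hT hOA
    ((hOmem m).2 (MulAction.mem_orbit_self m))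
    (fun n hn => apply_unit_eq_of_mem_orbit hTG ((hOmem n).1 hn))
    (fun n hn => val_eq_of_mem_orbit hw hG ((hOmem n).1 hn)) hσ
    (η := ε / 4) (by positivity) hb ((le_max_right _ _).trans_lt hr) ((le_max_left _ _).trans_lt hr)
  have hS : sumSMul continuous_coord O v ∈ invariantOperators Y (coord 𝕜 w) G :=
    sumSMul_mem_invariantOperators continuous_coord (fun g hg n => by
      rw [hOmem, hOmem]
      exact apply_mem_orbit_iff hg m n) v
  refine ⟨⟨_, Submodule.add_mem _ hTG hS⟩, hatt, ?_⟩
  have hd : dist (⟨T, hTG⟩ : invariantOperators Y (coord 𝕜 w) G)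
      ⟨_, Submodule.add_mem _ hTG hS⟩ = ‖sumSMul (continuous_coord (𝕜 := 𝕜) (w := w)) O v‖ := by
    rw [Subtype.dist_eq, dist_eq_norm, sub_add_cancel_left, norm_neg]
  rw [hd]
  refine (norm_sumSMul_le hw O v).trans_lt ?_
  rw [hv]
  nlinarith

/-- The `G`-invariant operators for which the weights of the relevant coordinates are summable. -/
noncomputable def summablySupported (w : Weight) (Y : Type*) [NormedAddCommGroup Y]
    [NormedSpace 𝕜 Y] (G : Subgroup (Equiv.Perm ℕ)) :
    Submodule 𝕜 (invariantOperators Y (coord 𝕜 w) G) where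
  carrier := {T | Summable ((support (T : XSpace 𝕜 w →L[𝕜] Y)).indicator w.val)}
  zero_mem' := by simp [support, summable_zero]
  add_mem' := by
    rintro S T hS hT
    -- The support of a sum lies in the union of the supports, so its weight is at most the sum of
    -- theirs.
    refine Summable.of_nonneg_of_le indicator_val_nonneg (fun n => ?_) (hS.add hT)
    have h1 := indicator_val_nonneg (w := w) (A := support (S : XSpace 𝕜 w →L[𝕜] Y)) n
    have h2 := indicator_val_nonneg (w := w) (A := support (T : XSpace 𝕜 w →L[𝕜] Y)) n
    by_cases hSn : n ∈ support (S : XSpace 𝕜 w →L[𝕜] Y)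
    · rw [indicator_of_mem hSn]
      exact (indicator_le_self' (fun m _ => (w.pos m).le) n).trans (by linarith)
    · by_cases hTn : n ∈ support (T : XSpace 𝕜 w →L[𝕜] Y)
      · rw [indicator_of_mem hTn]
        exact (indicator_le_self' (fun m _ => (w.pos m).le) n).trans (by linarith)
      · rw [indicator_of_notMem]
        · linarith
        · intro h
          refine h ?_
          simp [not_not.1 hSn, not_not.1 hTn]
  smul_mem' := by
    rintro c T hT
    have hsub : support ((c • T : invariantOperators Y (coord 𝕜 w) G) : XSpace 𝕜 w →L[𝕜] Y) ⊆
        support (T : XSpace 𝕜 w →L[𝕜] Y) := fun n hn h => hn (by simp [h])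
    exact Summable.of_nonneg_of_le indicator_val_nonneg (fun n =>
      indicator_le_indicator_of_subset hsub (fun m => (w.pos m).le) n) hT

theorem not_isPairSpaceable (hw : w.val 0 < 1) (hY : HasExtremeSpheres Y) [Nontrivial Y]
    (hcomp : IsCompatibleAction (coord 𝕜 w) G) (hG : 0 < permInfty G) {α β : Cardinal.{v}}
    (hα : ℵ₀ ≤ α) : ¬ IsPairSpaceable 𝕜 (nonApproximable Y (coord 𝕜 w) G) α β :=
  not_isPairSpaceable_nonApproximable continuous_coord hG coord_unit (summablySupported w Y G)
    (fun T N hN => by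
      refine summable_of_ne_finset_zero (s := Finset.range N) fun n hn => ?_
      exact indicator_of_notMem (s := support (T : XSpace 𝕜 w →L[𝕜] Y))
        (fun h => h (hN n (by simpa using hn))) _)
    (fun _ hT => summable_indicator_support_of_isNormAttaining hw hY hT)
    (fun T hT => mem_closure_isNormAttaining hw hcomp T hT) hα

end Invariant

end XSpace

theorem corollaryB2 {𝕜 : Type*} [RCLike 𝕜]
    (G : Subgroup (Equiv.Perm ℕ)) (hG : 0 < permInfty G)
    (α : Cardinal.{v}) (hα : ℵ₀ ≤ α) :
    (IsCompatibleAction (DStar.coord 𝕜 harmonicWeight) G →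
      ∀ (p : ℝ≥0∞) [Fact (1 ≤ p)], 1 < p → p < ∞ →
        ∀ β : Cardinal.{v}, α ≤ β →
          ¬ IsPairSpaceable 𝕜
            (nonApproximable (lp (fun _ : ℕ => 𝕜) p) (DStar.coord 𝕜 harmonicWeight) G) α β) ∧
    (∀ w : Weight, Summable (fun n => w.val n ^ 2) → w.val 0 < 1 →
      IsCompatibleAction (XSpace.coord 𝕜 w) G →
      ∀ (Y : Type u) [NormedAddCommGroup Y] [NormedSpace 𝕜 Y] [CompleteSpace Y],
        IsStrictlyConvex 𝕜 Y → ¬ FiniteDimensional 𝕜 Y →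
        (α ≤ Cardinal.continuum →
          ∀ β : Cardinal.{v}, α ≤ β →
            ¬ IsPairSpaceable 𝕜 (nonApproximable Y (XSpace.coord 𝕜 w) G) α β) ∧
        (TopologicalSpace.SeparableSpace Y →
          ∀ β : Cardinal.{v}, α ≤ β →
            ¬ IsPairSpaceable 𝕜 (nonApproximable Y (XSpace.coord 𝕜 w) G) α β)) := by
  constructor
  · intro _ p _ hp hp' β _
    have h1 : (lp.single p 0 (1 : 𝕜) : lp (fun _ : ℕ => 𝕜) p) ≠ 0 := fun h => by
      have := congrArg (fun f : lp (fun _ : ℕ => 𝕜) p => f 0) h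
      simp at this
    have : Nontrivial (lp (fun _ : ℕ => 𝕜) p) := ⟨_, _, h1⟩
    exact DStar.not_isPairSpaceable
      (lp.hasExtremeSpheres (StrictConvexSpace.hasExtremeSpheres 𝕜) p hp hp') hG hα
  · intro w _ hw hcomp Y _ _ _ hY hdim
    have : Nontrivial Y := by
      by_contra h
      rw [not_nontrivial_iff_subsingleton] at h
      exact hdim inferInstance
    have key : ∀ β : Cardinal.{v},
        ¬ IsPairSpaceable 𝕜 (nonApproximable Y (XSpace.coord 𝕜 w) G) α β := fun β =>
      XSpace.not_isPairSpaceable hw hY.hasExtremeSpheres hcomp hG hα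
    exact ⟨fun _ β _ => key β, fun _ β _ => key β⟩
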